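/- Let $\Phi$ be a homogeneous Poisson point process of density $\lambda>0$ on $\mathbb{R}^2$. For distinct atoms $x,y\in\Phi$ write $x\stackrel{\Phi}{\leftrightarrow}y$ if $y$ minimises the Euclidean distance to $x$ over $\Phi\setminus\{x\}$ and $x$ minimises the distance to $y$ over $\Phi\setminus\{y\}$. Let $\Phi^{(2)}$ be the set of atoms $x\in\Phi$ with $x\stackrel{\Phi}{\leftrightarrow}y$ for some $y\in\Phi$, and let $\Phi^{(1)}=\Phi\setminus\Phi^{(2)}$ be the set of single atoms. Put $\gamma=\frac23-\frac{\sqrt3}{2\pi}$ and $\delta=\frac1{2-\gamma}$. Let $f=(f(x))_{x\in\mathbb{R}^2}$ and $g=(g(x,y))_{x,y\in\mathbb{R}^2}$ be $[0,\infty]$-valued measurable random fields, each independent of $\Phi$ (that is, jointly measurable in position and in a random element independent of $\Phi$), and define $$\mathcal I^{(1)}=\sum_{x\in\Phi^{(1)}}f(x),\qquad \mathcal I^{(2)}=\frac12\sum_{x\in\Phi^{(2)}}\ \sum_{y\in\Phi^{(2)}\setminus\{x\}}g(x,y)\,\mathbf 1_{\{x\stackrel{\Phi}{\leftrightarrow}y\}}.$$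 Then $\mathcal I^{(1)}$ and $\mathcal I^{(2)}$ are random variables (up to null sets) and, as an identity in $[0,\infty]$, $$\mathbb E[\mathcal I^{(1)}]=(1-\delta)\int_{\mathbb R^2}\mathbb E[f(x)]\,\lambda\,dx,\qquad \mathbb E[\mathcal I^{(2)}]=\frac12\int_{\mathbb R^2}\int_{\mathbb R^2}\mathbb E[g(x,y)]\,e^{-\lambda\pi\|x-y\|^2(2-\gamma)}\,\lambda\,dy\,\lambda\,dx.$$ The same formulas hold when the signals are attached to the atoms (as with i.i.d. fading variables): if $X_0,X_1,\dots$ is a measurable enumeration without repetition of the atoms of $\Phi$ and $(s_n)$, respectively $(t_{n,m})$, is a family of measurable random fields jointly independent of $(X_n)$, with $s_n(x)$ distributed as $f(x)$, respectively $t_{n,m}(x,y)$ ($n\ne m$) distributed as $g(x,y)$, for all positions, then $f(x)$ may be replaced by $s_n(x)$ at the atom $x=X_n$ in $\mathcal I^{(1)}$, and $g(x,y)$ by $t_{n,m}(x,y)$ at the pair of atoms $x=X_n$, $y=X_m$ in $\mathcal I^{(2)}$; here $f$ and $g$ matter only through the laws of $f(x)$ and $g(x,y)$ at fixed positions. -/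

import Mathlib

open MeasureTheory ProbabilityTheory
open scoped ENNReal NNReal

namespace MutualNN

/-- The Euclidean plane, with its Euclidean norm and Lebesgue measure. -/
abbrev Plane : Type := EuclideanSpace ℝ (Fin 2)

/-- Simple, locally finite configurations of points of the plane. -/
structure Config where
  /-- the set of atoms -/
  atoms : Set Plane
  locallyFinite : ∀ K : Set Plane, IsCompact K → (atoms ∩ K).Finite

namespace Config

/-- Number of atoms of the configuration in `B`. -/
noncomputable def count (φ : Config) (B : Set Plane) : ℕ∞ := (φ.atoms ∩ B).encard

/-- The σ-algebra generated by the counting maps `φ ↦ φ(B)`, `B` Borel. -/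
noncomputable instance : MeasurableSpace Config :=
  ⨆ (B : Set Plane) (_ : MeasurableSet B), MeasurableSpace.comap (fun φ => φ.count B) ⊤

/-- Nearest neighbour relation: `x ≠ y` are atoms and `y` minimises `‖x - z‖` over the atoms
`z ≠ x`. -/
def NNR (φ : Config) (x y : Plane) : Prop :=
  x ∈ φ.atoms ∧ y ∈ φ.atoms ∧ x ≠ y ∧ ∀ z ∈ φ.atoms, z ≠ x → ‖x - y‖ ≤ ‖x - z‖

/-- Mutually nearest neighbour relation. -/
def MNNR (φ : Config) (x y : Plane) : Prop := φ.NNR x y ∧ φ.NNR y x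

/-- The single atoms: those in mutually nearest neighbour relation with no other atom. -/
def singles (φ : Config) : Set Plane := {x | x ∈ φ.atoms ∧ ∀ y ∈ φ.atoms, ¬ φ.MNNR x y}

/-- The cooperating atoms: those in mutually nearest neighbour relation with some other atom. -/
def cooperating (φ : Config) : Set Plane := {x | x ∈ φ.atoms ∧ ∃ y ∈ φ.atoms, φ.MNNR x y}

/-- Interference of the singles, `∑_{x single} f(x)`. -/
noncomputable def interference₁ (φ : Config) (f : Plane → ℝ≥0∞) : ℝ≥0∞ :=
  ∑' x : φ.singles, f x

open Classical in
/-- Interference of the pairs, `½ ∑_x ∑_{y ≠ x} g(x,y) 1{x ↔ y}` over cooperating `x`, `y`. -/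
noncomputable def interference₂ (φ : Config) (g : Plane → Plane → ℝ≥0∞) : ℝ≥0∞ :=
  2⁻¹ * ∑' x : φ.cooperating, ∑' y : (φ.cooperating \ {(x : Plane)} : Set Plane),
    if φ.MNNR x y then g x y else 0

open Classical in
/-- Interference of the singles when the atoms are listed as `p 0, p 1, …` and the `n`-th atom
uses its own signal function `s n`. -/
noncomputable def atomInterference₁ (φ : Config) (p : ℕ → Plane)
    (s : ℕ → Plane → ℝ≥0∞) : ℝ≥0∞ :=
  ∑' n, if p n ∈ φ.singles then s n (p n) else 0

open Classical in
/-- Interference of the pairs when the atoms are listed as `p 0, p 1, …` and the `n`-th and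
`m`-th atoms together use their own signal function `t n m`. -/
noncomputable def atomInterference₂ (φ : Config) (p : ℕ → Plane)
    (t : ℕ → ℕ → Plane → Plane → ℝ≥0∞) : ℝ≥0∞ :=
  2⁻¹ * ∑' n, ∑' m, if n ≠ m ∧ φ.MNNR (p n) (p m) then t n m (p n) (p m) else 0

end Config

/-- `γ = 2/3 - √3/(2π)`. -/
noncomputable def gammaConst : ℝ := 2 / 3 - √3 / (2 * Real.pi)

/-- `δ = 1/(2 - γ)`. -/
noncomputable def deltaConst : ℝ := 1 / (2 - gammaConst)

/-- `Φ` is a (homogeneous) Poisson point process of density `lam` on the plane: the number of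
atoms in a Borel set `B` of finite area is Poisson with mean `lam * area(B)`, and the numbers of
atoms in finitely many pairwise disjoint Borel sets are independent. -/
structure IsPoissonProcess {Ω : Type*} [MeasurableSpace Ω] (P : Measure Ω) (lam : ℝ≥0) (Φ : Ω → Config) : Prop where
  measurable : Measurable Φ
  poisson : ∀ B : Set Plane, MeasurableSet B → volume B ≠ ∞ → ∀ k : ℕ,
    P {ω | (Φ ω).count B = k} =
      ENNReal.ofReal (Real.exp (-(lam * (volume B).toReal)) *
        (lam * (volume B).toReal) ^ k / (k.factorial : ℝ))
  indep : ∀ (n : ℕ) (B : Fin n → Set Plane), (∀ i, MeasurableSet (B i)) →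
    Pairwise (fun i j => Disjoint (B i) (B j)) →
    iIndepFun (fun i ω => (Φ ω).count (B i)) P

/-- `F` is a measurable random field on `T` carried by a σ-algebra `𝒢`: it is jointly measurable
for the product of the σ-algebra of `T` with `𝒢`. -/
def IsFieldOver {Ω T : Type*} [mT : MeasurableSpace T] (𝒢 : MeasurableSpace Ω)
    (F : T → Ω → ℝ≥0∞) : Prop :=
  @Measurable (T × Ω) ℝ≥0∞ (mT.prod 𝒢) _ (fun p => F p.1 p.2)

/-- `F` is a measurable random field on `T` independent of `Φ`: it is carried by a σ-algebra of
events independent of `Φ`. (Joint measurability together with independence of `Φ` from the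
values at fixed points would not suffice, as the field `x ↦ 1{x ∈ Φ}` shows.) -/
def IsIndepField {Ω T : Type*} [mΩ : MeasurableSpace Ω] [MeasurableSpace T] (P : Measure Ω)
    (Φ : Ω → Config) (F : T → Ω → ℝ≥0∞) : Prop :=
  ∃ 𝒢 : MeasurableSpace Ω, 𝒢 ≤ mΩ ∧
    Indep 𝒢 (MeasurableSpace.comap Φ inferInstance) P ∧ IsFieldOver 𝒢 F

/-- `X 0, X 1, …` is almost surely a list without repetition of the atoms of `Φ`. -/
structure IsEnumeration {Ω : Type*} [MeasurableSpace Ω] (P : Measure Ω) (Φ : Ω → Config)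
    (X : ℕ → Ω → Plane) : Prop where
  measurable : ∀ n, Measurable (X n)
  enum : ∀ᵐ ω ∂P, Function.Injective (fun n => X n ω) ∧ Set.range (fun n => X n ω) = (Φ ω).atoms

/-- The fields `F i` are measurable random fields, jointly independent of the sequence `X`. -/
def IsIndepFieldFamily {Ω ι T : Type*} [mΩ : MeasurableSpace Ω] [MeasurableSpace T]
    (P : Measure Ω) (X : ℕ → Ω → Plane) (F : ι → T → Ω → ℝ≥0∞) : Prop :=
  ∃ 𝒢 : MeasurableSpace Ω, 𝒢 ≤ mΩ ∧
    Indep 𝒢 (MeasurableSpace.comap (fun ω n => X n ω) inferInstance) P ∧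
    ∀ i, IsFieldOver 𝒢 (F i)

/-- `(1 - δ) ∫ E[f(x)] λ dx`. -/
noncomputable def singlesFormula {Ω : Type*} [MeasurableSpace Ω] (P : Measure Ω) (lam : ℝ≥0)
    (f : Plane → Ω → ℝ≥0∞) : ℝ≥0∞ :=
  ENNReal.ofReal (1 - deltaConst) * ∫⁻ x, (∫⁻ ω, f x ω ∂P) * lam

/-- `½ ∫∫ E[g(x,y)] exp(-λ π ‖x - y‖² (2 - γ)) λ dy λ dx`. -/
noncomputable def pairsFormula {Ω : Type*} [MeasurableSpace Ω] (P : Measure Ω) (lam : ℝ≥0)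
    (g : Plane → Plane → Ω → ℝ≥0∞) : ℝ≥0∞ :=
  2⁻¹ * ∫⁻ x, (∫⁻ y, (∫⁻ ω, g x y ω ∂P) *
    ENNReal.ofReal (Real.exp (-(lam * Real.pi * ‖x - y‖ ^ 2 * (2 - gammaConst)))) * lam) * lam

end MutualNN

/-! Both means come from Mecke's formula: for a Poisson process, the expected sum of `F x Φ` over
the atoms `x` is the integral of the expectation of `F x (Φ + x)` against the intensity `λ dx`
(`lintegral_lintegral_atomKernel`). Applied twice, it turns a sum over pairs into a double integral
weighted by the probability that `x` and `y` become mutual nearest neighbours once both are added.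
This happens exactly when no other atom lies in the union of the two discs of radius `‖x - y‖` about
`x` and `y`. Two unit discs with centres at distance one meet in area `π γ`, so the union has area
`π ‖x - y‖² (2 - γ)`, and the Poisson void probability is the exponential in the formula.

For singles, almost surely no two atoms are equidistant from a given point `x`, so an added `x` has
at most one mutual neighbour. The probability that it has one is thus the expected number of such
neighbours, a Gaussian integral equal to `δ` (`law_cooperating_cons`); an added point is single with
probability `1 - δ`.

Random signals are averaged out by Tonelli, conditionally on the process
(`lintegral_comp_of_indep`). For signals attached to atoms, the same averaging is done term by term
along the enumeration, and the averaged sums coincide with those for deterministic fields. -/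

namespace MutualNN
namespace Config

/-! ### Void events generate the σ-algebra of configurations -/

theorem countable_atoms (φ : Config) : φ.atoms.Countable := by
  have h : φ.atoms = ⋃ n : ℕ, φ.atoms ∩ Metric.closedBall 0 n := by
    rw [← Set.inter_iUnion, Metric.iUnion_closedBall_nat, Set.inter_univ]
  rw [h]
  exact Set.countable_iUnion fun n =>
    (φ.locallyFinite _ (isCompact_closedBall _ _)).countable

theorem measurable_count {B : Set Plane} (hB : MeasurableSet B) :
    Measurable fun φ : Config => φ.count B := by
  rw [measurable_iff_comap_le]
  exact le_iSup₂ (f := fun (B : Set Plane) (_ : MeasurableSet B) =>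
    MeasurableSpace.comap (fun φ : Config => φ.count B) ⊤) B hB

/-- The event that there is no atom in `B`. -/
def void (B : Set Plane) : Set Config := {φ | φ.count B = 0}

theorem mem_void {φ : Config} {B : Set Plane} : φ ∈ void B ↔ Disjoint φ.atoms B := by
  simp [void, count, Set.encard_eq_zero, Set.disjoint_iff_inter_eq_empty]

theorem measurableSet_void {B : Set Plane} (hB : MeasurableSet B) : MeasurableSet (void B) :=
  measurable_count hB (measurableSet_singleton 0)

theorem void_inter (B C : Set Plane) : void B ∩ void C = void (B ∪ C) := by
  ext φ
  simp [mem_void]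

/-- The void events. -/
def voidEvents : Set (Set Config) := {s | ∃ B, MeasurableSet B ∧ void B = s}

theorem isPiSystem_voidEvents : IsPiSystem voidEvents := by
  rintro _ ⟨B, hB, rfl⟩ _ ⟨C, hC, rfl⟩ _
  exact ⟨B ∪ C, hB.union hC, (void_inter B C).symm⟩

/-- Finitely many points of a Hausdorff space have disjoint neighbourhoods, which can be taken in a
countable basis. Counting is thereby expressed through void events, with only countably many choices
of neighbourhoods. -/
theorem le_count_iff (φ : Config) (B : Set Plane) (m : ℕ) :
    (m : ℕ∞) ≤ φ.count B ↔
      ∃ u : Fin m → TopologicalSpace.countableBasis Plane,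
        (∀ i j, i ≠ j → Disjoint (u i : Set Plane) (u j)) ∧
          ∀ i, φ ∉ void (B ∩ u i) := by
  constructor
  · intro h
    obtain ⟨t, ht, htm⟩ := Set.exists_subset_encard_eq h
    have hfin : t.Finite := Set.finite_of_encard_eq_coe htm
    obtain ⟨U, hU, hd⟩ := hfin.t2_separation
    have hcard : hfin.toFinset.card = m := by
      rw [hfin.encard_eq_coe_toFinset_card] at htm
      exact_mod_cast htm
    let e := hfin.toFinset.equivFinOfCardEq hcard
    have hmem : ∀ i, ((e.symm i : hfin.toFinset) : Plane) ∈ t := fun i =>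
      hfin.mem_toFinset.1 (e.symm i).2
    have hb : ∀ i, ∃ v : TopologicalSpace.countableBasis Plane,
        ((e.symm i : hfin.toFinset) : Plane) ∈ (v : Set Plane) ∧
          (v : Set Plane) ⊆ U (e.symm i : hfin.toFinset) := fun i => by
      obtain ⟨v, hv, hxv, hvU⟩ :=
        (TopologicalSpace.isBasis_countableBasis Plane).exists_subset_of_mem_open
          (hU _).1 (hU ((e.symm i : hfin.toFinset) : Plane)).2
      exact ⟨⟨v, hv⟩, hxv, hvU⟩
    choose u hu huU using hb
    refine ⟨u, fun i j hij => ?_, fun i => ?_⟩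
    · refine (hd (hmem i) (hmem j) fun he => hij ?_).mono (huU i) (huU j)
      exact e.symm.injective (Subtype.ext he)
    · rw [mem_void]
      exact Set.not_disjoint_iff.2 ⟨_, (ht (hmem i)).1, (ht (hmem i)).2, hu i⟩
  · rintro ⟨u, hd, hu⟩
    simp only [mem_void, Set.not_disjoint_iff] at hu
    choose x hx using hu
    have hinj : Function.Injective x := fun i j hij => by
      by_contra hne
      exact Set.disjoint_left.1 (hd i j hne) (hx i).2.2 (hij ▸ (hx j).2.2)
    have : (Set.range x).encard = m := by
      rw [← Set.image_univ, hinj.encard_image, Set.encard_univ]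
      simp
    rw [← this]
    exact Set.encard_le_encard (Set.range_subset_iff.2 fun i => ⟨(hx i).1, (hx i).2.1⟩)

/-- By `le_count_iff`, each event `m ≤ φ.count B` is a countable union of finite intersections of
complements of void events. Since void events form a π-system, they suffice to identify measures in
Mecke's formula. -/
theorem generateFrom_voidEvents :
    (inferInstance : MeasurableSpace Config) = MeasurableSpace.generateFrom voidEvents := by
  apply le_antisymm
  · have hge : ∀ B : Set Plane, MeasurableSet B → ∀ m : ℕ,
        MeasurableSet[MeasurableSpace.generateFrom voidEvents]
          {φ : Config | (m : ℕ∞) ≤ φ.count B} := by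
      intro B hB m
      have : {φ : Config | (m : ℕ∞) ≤ φ.count B} =
          ⋃ u : {u : Fin m → TopologicalSpace.countableBasis Plane //
            ∀ i j, i ≠ j → Disjoint (u i : Set Plane) (u j)}, ⋂ i, (void (B ∩ u.1 i))ᶜ := by
        ext φ
        simp only [Set.mem_ofPred_eq, le_count_iff, Set.mem_iUnion, Set.mem_iInter,
          Set.mem_compl_iff, Subtype.exists, exists_prop]
      rw [this]
      have : Countable (TopologicalSpace.countableBasis Plane) :=
        (TopologicalSpace.countable_countableBasis Plane).to_subtype
      refine @MeasurableSet.iUnion _ _ (_) _ _ fun u => @MeasurableSet.iInter _ _ (_) _ _ fun i =>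
        @MeasurableSet.compl _ _ (_) (MeasurableSpace.measurableSet_generateFrom
          ⟨_, hB.inter ?_, rfl⟩)
      exact ((TopologicalSpace.isBasis_countableBasis Plane).isOpen (u.1 i).2).measurableSet
    refine iSup₂_le fun B hB => ?_
    rw [← measurable_iff_comap_le]
    refine @measurable_to_countable' ℕ∞ Config _ _ (_) _ fun k => ?_
    induction k using ENat.recTopCoe with
    | top =>
      have : (fun φ : Config => φ.count B) ⁻¹' {⊤} =
          ⋂ m : ℕ, {φ : Config | (m : ℕ∞) ≤ φ.count B} := by
        ext φ
        simp [ENat.eq_top_iff_forall_ge]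
      rw [this]
      exact @MeasurableSet.iInter _ _ (_) _ _ fun m => hge B hB m
    | coe k =>
      have : (fun φ : Config => φ.count B) ⁻¹' {(k : ℕ∞)} =
          {φ : Config | (k : ℕ∞) ≤ φ.count B} \ {φ : Config | ((k + 1 : ℕ) : ℕ∞) ≤ φ.count B} := by
        ext φ
        simp only [Set.mem_preimage, Set.mem_singleton_iff, Set.mem_sdiff, Set.mem_ofPred_eq, not_le]
        push_cast
        rw [ENat.lt_add_one_iff (ENat.natCast_ne_top k)]
        exact ⟨fun h => ⟨h.ge, h.le⟩, fun h => le_antisymm h.2 h.1⟩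
      rw [this]
      exact @MeasurableSet.diff _ (_) _ _ (hge B hB k) (hge B hB (k + 1))
  · apply MeasurableSpace.generateFrom_le
    rintro _ ⟨B, hB, rfl⟩
    exact measurableSet_void hB

/-! ### Sums over atoms as integrals against an s-finite kernel -/

/-- The kernel sending a configuration to the counting measure on its atoms. -/
noncomputable def atomKernel : Kernel Config Plane where
  toFun φ := Measure.count.restrict φ.atoms
  measurable' := by
    refine Measure.measurable_of_measurable_coe _ fun B hB => ?_
    have : (fun φ : Config => Measure.count.restrict φ.atoms B) =
        fun φ : Config => ((φ.count B : ℕ∞) : ℝ≥0∞) := by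
      ext φ
      rw [Measure.restrict_apply hB,
        Measure.count_apply (hB.inter φ.countable_atoms.measurableSet), count, Set.inter_comm]
    rw [this]
    exact (measurable_of_countable _).comp (measurable_count hB)

theorem atomKernel_apply (φ : Config) {B : Set Plane} (hB : MeasurableSet B) :
    atomKernel φ B = ((φ.count B : ℕ∞) : ℝ≥0∞) := by
  change Measure.count.restrict φ.atoms B = _
  rw [Measure.restrict_apply hB,
        Measure.count_apply (hB.inter φ.countable_atoms.measurableSet), count, Set.inter_comm]

theorem lintegral_atomKernel (φ : Config) (f : Plane → ℝ≥0∞) :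
    ∫⁻ x, f x ∂(atomKernel φ) = ∑' x : φ.atoms, f x := by
  change ∫⁻ x, f x ∂(Measure.count.restrict φ.atoms) = _
  rw [lintegral_countable _ φ.countable_atoms]
  simp

theorem count_lt_top (φ : Config) {B : Set Plane} (hB : Bornology.IsBounded B) :
    φ.count B < ⊤ := by
  rw [count, Set.encard_lt_top_iff]
  exact (φ.locallyFinite _ hB.isCompact_closure).subset
    (Set.inter_subset_inter_right _ subset_closure)

/-- The annulus of points whose norm has integer part `n`. -/
def shell (n : ℕ) : Set Plane := {x | ⌊‖x‖⌋₊ = n}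

theorem measurableSet_shell (n : ℕ) : MeasurableSet (shell n) :=
  (Nat.measurable_floor.comp measurable_norm) (measurableSet_singleton n)

theorem isBounded_shell (n : ℕ) : Bornology.IsBounded (shell n) := by
  refine Metric.isBounded_closedBall (x := (0 : Plane)) (r := n + 1) |>.subset fun x hx => ?_
  rw [mem_closedBall_zero_iff, ← show ⌊‖x‖⌋₊ = n from hx]
  exact (Nat.lt_floor_add_one _).le

theorem iUnion_shell : ⋃ n, shell n = Set.univ :=
  Set.eq_univ_of_forall fun x => Set.mem_iUnion.2 ⟨⌊‖x‖⌋₊, rfl⟩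

theorem pairwise_disjoint_shell : Pairwise (Function.onFun Disjoint shell) := fun m n hmn =>
  Set.disjoint_left.2 fun x hm hn => hmn (by rw [← show ⌊‖x‖⌋₊ = m from hm]; exact hn)

/-- The mass of a bounded set is finite for each configuration but not uniformly so. Splitting by
shell and by the number `k` of atoms in it gives countably many kernels, each of mass at most `k`;
for a given configuration and shell only one value of `k` contributes. S-finiteness is what Tonelli
and the composition product need. -/
instance isSFiniteKernel_atomKernel : IsSFiniteKernel atomKernel := by
  classical
  let s : ℕ × ℕ → Set Config := fun p => {φ | φ.count (shell p.1) = p.2}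
  have hs : ∀ p, MeasurableSet (s p) := fun p =>
    measurable_count (measurableSet_shell p.1) (measurableSet_singleton _)
  let κ : ℕ × ℕ → Kernel Config Plane := fun p =>
    Kernel.piecewise (hs p) (atomKernel.restrict (measurableSet_shell p.1)) 0
  have hκ : ∀ p, IsFiniteKernel (κ p) := fun p => by
    refine ⟨⟨(p.2 : ℝ≥0∞), by simp, fun φ => ?_⟩⟩
    rw [Kernel.piecewise_apply']
    split_ifs with h
    · rw [Kernel.restrict_apply, Measure.restrict_apply_univ,
        atomKernel_apply _ (measurableSet_shell _), show φ.count (shell p.1) = p.2 from h]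
      simp
    · simp
  have : atomKernel = Kernel.sum κ := by
    ext φ B hB
    rw [Kernel.sum_apply' _ _ hB]
    rw [ENNReal.tsum_prod']
    have : ∀ n, ∑' k, κ (n, k) φ B = atomKernel φ (B ∩ shell n) := fun n => by
      obtain ⟨k, hk⟩ := ENat.ne_top_iff_exists.1 (φ.count_lt_top (isBounded_shell n)).ne
      rw [tsum_eq_single k]
      · rw [Kernel.piecewise_apply', if_pos (show φ ∈ s (n, k) from hk.symm),
          Kernel.restrict_apply' _ _ _ hB]
      · intro j hj
        rw [Kernel.piecewise_apply', if_neg]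
        · simp
        · intro (h : φ.count (shell n) = j)
          rw [← hk] at h
          exact hj (by exact_mod_cast h.symm)
    simp_rw [this]
    rw [← measure_iUnion _ fun n => hB.inter (measurableSet_shell n), ← Set.inter_iUnion,
      iUnion_shell, Set.inter_univ]
    exact fun m n hmn => (pairwise_disjoint_shell hmn).mono Set.inter_subset_right
      Set.inter_subset_right
  rw [this]
  exact Kernel.isSFiniteKernel_sum (hκs := fun p => inferInstance)

theorem measurable_of_void {α : Type*} [MeasurableSpace α] {f : α → Config}
    (h : ∀ B, MeasurableSet B → MeasurableSet (f ⁻¹' void B)) : Measurable f := by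
  have := @measurable_generateFrom α Config _ voidEvents f
    (by rintro _ ⟨B, hB, rfl⟩; exact h B hB)
  rwa [← generateFrom_voidEvents] at this

/-! ### Adding a point; measurability of the neighbour relations -/

/-- The configuration with one more point. -/
def cons (x : Plane) (φ : Config) : Config where
  atoms := insert x φ.atoms
  locallyFinite K hK := by
    refine ((φ.locallyFinite K hK).insert x).subset ?_
    rintro y ⟨rfl | hy, hyK⟩
    · exact Set.mem_insert _ _
    · exact Set.mem_insert_of_mem _ ⟨hy, hyK⟩

theorem cons_mem_void {x : Plane} {φ : Config} {B : Set Plane} :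
    cons x φ ∈ void B ↔ x ∉ B ∧ φ ∈ void B := by
  simp [mem_void, cons]

theorem measurable_cons {α : Type*} [MeasurableSpace α] {f : α → Plane} {F : α → Config}
    (hf : Measurable f) (hF : Measurable F) : Measurable fun a => cons (f a) (F a) := by
  refine measurable_of_void fun B hB => ?_
  have : (fun a => cons (f a) (F a)) ⁻¹' void B = f ⁻¹' Bᶜ ∩ F ⁻¹' void B := by
    ext a
    simp [cons_mem_void]
  rw [this]
  exact (hf hB.compl).inter (hF (measurableSet_void hB))

theorem measurable_lintegral_atomKernel {α : Type*} [MeasurableSpace α] {F : α → Config}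
    (hF : Measurable F) {f : α → Plane → ℝ≥0∞} (hf : Measurable (Function.uncurry f)) :
    Measurable fun a => ∫⁻ y, f a y ∂(atomKernel (F a)) :=
  hf.lintegral_kernel_prod_right (κ := atomKernel.comap F hF)

/-- An atom with the property exists exactly when the indicator of the property has nonzero integral
against the counting measure, and that integral is measurable in the parameter. -/
theorem measurableSet_exists_atom {α : Type*} [MeasurableSpace α] {F : α → Config}
    (hF : Measurable F) {p : α → Plane → Prop}
    (hp : MeasurableSet {z : α × Plane | p z.1 z.2}) :
    MeasurableSet {a | ∃ y ∈ (F a).atoms, p a y} := by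
  have hm := measurable_lintegral_atomKernel hF
    (f := fun a y => Set.indicator {z : α × Plane | p z.1 z.2} 1 (a, y))
    (measurable_one.indicator hp)
  convert (hm (measurableSet_singleton 0)).compl using 1
  ext a
  simp only [Set.mem_compl_iff, Set.mem_preimage, Set.mem_singleton_iff,
    lintegral_atomKernel, ENNReal.tsum_eq_zero, not_forall, Set.mem_ofPred_eq]
  simp

section
variable {α : Type*} [MeasurableSpace α] {F : α → Config} {f g : α → Plane}

theorem measurableSet_mem_atoms (hF : Measurable F) (hf : Measurable f) :
    MeasurableSet {a | f a ∈ (F a).atoms} := by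
  have := measurableSet_exists_atom hF (p := fun a y => y = f a)
    (measurableSet_eq_fun measurable_snd (hf.comp measurable_fst))
  simpa using this

theorem measurableSet_NNR (hF : Measurable F) (hf : Measurable f) (hg : Measurable g) :
    MeasurableSet {a | (F a).NNR (f a) (g a)} := by
  have h3 : MeasurableSet {a | f a = g a} := measurableSet_eq_fun hf hg
  have h4 := measurableSet_exists_atom hF
    (p := fun a z => z ≠ f a ∧ ‖f a - z‖ < ‖f a - g a‖) (by
      have h1 : MeasurableSet {z : α × Plane | z.2 = f z.1} :=
        measurableSet_eq_fun measurable_snd (hf.comp measurable_fst)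
      have h2 : MeasurableSet {z : α × Plane | ‖f z.1 - z.2‖ < ‖f z.1 - g z.1‖} :=
        measurableSet_lt (by fun_prop) (by fun_prop)
      exact h1.compl.inter h2)
  convert (measurableSet_mem_atoms hF hf).inter
    ((measurableSet_mem_atoms hF hg).inter (h3.compl.inter h4.compl)) using 1
  ext a
  simp only [NNR, Set.mem_inter_iff, Set.mem_ofPred_eq, Set.mem_compl_iff, not_exists, not_and,
    not_lt]

theorem measurableSet_MNNR (hF : Measurable F) (hf : Measurable f) (hg : Measurable g) :
    MeasurableSet {a | (F a).MNNR (f a) (g a)} :=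
  (measurableSet_NNR hF hf hg).inter (measurableSet_NNR hF hg hf)

theorem measurableSet_cooperating (hF : Measurable F) (hf : Measurable f) :
    MeasurableSet {a | f a ∈ (F a).cooperating} :=
  (measurableSet_mem_atoms hF hf).inter
    (measurableSet_exists_atom hF
      (measurableSet_MNNR (hF.comp measurable_fst) (hf.comp measurable_fst) measurable_snd))

theorem mem_singles_iff {φ : Config} {x : Plane} :
    x ∈ φ.singles ↔ x ∈ φ.atoms ∧ x ∉ φ.cooperating := by
  simp only [singles, cooperating, Set.mem_ofPred_eq, not_and, not_exists]
  tauto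

theorem measurableSet_singles (hF : Measurable F) (hf : Measurable f) :
    MeasurableSet {a | f a ∈ (F a).singles} := by
  simp only [mem_singles_iff]
  exact (measurableSet_mem_atoms hF hf).inter (measurableSet_cooperating hF hf).compl

end

theorem MNNR.symm {φ : Config} {x y : Plane} (h : φ.MNNR x y) : φ.MNNR y x := ⟨h.2, h.1⟩

/-! ### Interference as an integral over atoms -/

open Classical in
theorem interference₁_eq (φ : Config) (f : Plane → ℝ≥0∞) :
    φ.interference₁ f = ∫⁻ x, (if x ∈ φ.singles then f x else 0) ∂(atomKernel φ) := by
  rw [lintegral_atomKernel, interference₁, tsum_subtype φ.singles f,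
    tsum_subtype φ.atoms fun x => if x ∈ φ.singles then f x else 0]
  congr 1
  ext x
  by_cases h : x ∈ φ.singles
  · simp [h, h.1]
  · simp [h, Set.indicator_apply]

open Classical in
theorem interference₂_eq (φ : Config) (g : Plane → Plane → ℝ≥0∞) :
    φ.interference₂ g = 2⁻¹ * ∫⁻ x, ∫⁻ y, (if φ.MNNR x y then g x y else 0)
      ∂(atomKernel φ) ∂(atomKernel φ) := by
  have inner : ∀ x : Plane, (∑' y : (φ.cooperating \ {x} : Set Plane),
      if φ.MNNR x y then g x y else 0) =
      ∑' y : φ.atoms, if φ.MNNR x y then g x y else 0 := by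
    intro x
    rw [tsum_subtype (φ.cooperating \ {x}) fun y => if φ.MNNR x y then g x y else 0,
      tsum_subtype φ.atoms fun y => if φ.MNNR x y then g x y else 0]
    congr 1
    ext y
    by_cases h : φ.MNNR x y
    · have hy : y ∈ φ.cooperating := ⟨h.1.2.1, x, h.1.1, h.symm⟩
      simp [h, hy, h.1.2.1, h.1.2.2.1.symm]
    · simp [h, Set.indicator_apply]
  have h2 : ∀ x : Plane, ∫⁻ y, (if φ.MNNR x y then g x y else 0) ∂(atomKernel φ) =
      ∑' y : φ.atoms, if φ.MNNR x y then g x y else 0 := fun x => lintegral_atomKernel φ _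
  rw [lintegral_congr h2, lintegral_atomKernel, interference₂,
    tsum_congr fun x : φ.cooperating => inner x,
    tsum_subtype φ.cooperating fun x => ∑' y : φ.atoms, if φ.MNNR x y then g x y else 0,
    tsum_subtype φ.atoms fun x => ∑' y : φ.atoms, if φ.MNNR x y then g x y else 0]
  congr 2
  ext x
  by_cases h : x ∈ φ.cooperating
  · simp [h, h.1]
  · by_cases hx : x ∈ φ.atoms
    · have : ∀ y : φ.atoms, ¬ φ.MNNR x y := fun y hy => h ⟨hx, y, y.2, hy⟩
      simp [h, this, Set.indicator_apply]
    · simp [h, hx]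

end Config

open Config

/-! ### Mecke's formula -/

/-- The intensity measure of a Poisson process of density `lam`. -/
noncomputable def intensity (lam : ℝ≥0) : Measure Plane := (lam : ℝ≥0∞) • volume

instance (lam : ℝ≥0) : SigmaFinite (intensity lam) :=
  inferInstanceAs (SigmaFinite (lam • (volume : Measure Plane)))

theorem lintegral_intensity (lam : ℝ≥0) (f : Plane → ℝ≥0∞) :
    ∫⁻ x, f x ∂(intensity lam) = ∫⁻ x, f x * lam := by
  rw [intensity, lintegral_smul_measure, lintegral_mul_const' _ _ ENNReal.coe_ne_top, mul_comm,
    smul_eq_mul, mul_comm, mul_comm]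

namespace IsPoissonProcess

variable {Ω : Type*} [MeasurableSpace Ω] {P : Measure Ω} [IsProbabilityMeasure P]
  {lam : ℝ≥0} {Φ : Ω → Config}

/-- The Poisson weights satisfy `(k + 1) p (k + 1) = m * p k`, so the mean is `m` times their total
mass. -/
theorem lintegral_count (hΦ : IsPoissonProcess P lam Φ) {A : Set Plane} (hA : MeasurableSet A)
    (hb : Bornology.IsBounded A) :
    ∫⁻ ω, (((Φ ω).count A : ℕ∞) : ℝ≥0∞) ∂P = intensity lam A := by
  have hfin : volume A ≠ ∞ := hb.measure_lt_top.ne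
  set m : ℝ := lam * (volume A).toReal with hm
  have hm0 : 0 ≤ m := by positivity
  have hint : intensity lam A = ENNReal.ofReal m := by
    rw [hm, ENNReal.ofReal_mul (by positivity), ENNReal.ofReal_toReal hfin]
    simp [intensity]
  have hc : Measurable fun ω => (Φ ω).count A := (measurable_count hA).comp hΦ.measurable
  set K : Ω → ℕ := fun ω => ((Φ ω).count A).toNat with hK
  have hKm : Measurable K := (measurable_of_countable _).comp hc
  have hKc : ∀ ω, (Φ ω).count A = (K ω : ℕ∞) := fun ω =>
    (ENat.natCast_toNat ((Φ ω).count_lt_top hb).ne).symm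
  have hPK : ∀ k, P.map K {k} =
      ENNReal.ofReal (Real.exp (-m) * m ^ k / (k.factorial : ℝ)) := fun k => by
    rw [Measure.map_apply hKm (measurableSet_singleton k), ← hΦ.poisson A hA hfin k]
    congr 1
    ext ω
    simp [hKc]
  have : IsProbabilityMeasure (P.map K) := Measure.isProbabilityMeasure_map hKm.aemeasurable
  have hsum : ∑' k, P.map K {k} = 1 := by
    have := lintegral_countable' (μ := P.map K) (fun _ => 1)
    simpa using this.symm
  have hstep : ∀ k : ℕ, ((k + 1 : ℕ) : ℝ≥0∞) * P.map K {k + 1} =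
      ENNReal.ofReal m * P.map K {k} := fun k => by
    rw [hPK, hPK, ← ENNReal.ofReal_natCast, ← ENNReal.ofReal_mul (by positivity),
      ← ENNReal.ofReal_mul hm0]
    congr 1
    rw [Nat.factorial_succ]
    push_cast
    field_simp
    ring
  calc ∫⁻ ω, (((Φ ω).count A : ℕ∞) : ℝ≥0∞) ∂P = ∫⁻ ω, (K ω : ℝ≥0∞) ∂P := by
        simp [hKc]
    _ = ∫⁻ k : ℕ, (k : ℝ≥0∞) ∂(P.map K) :=
        (lintegral_map (measurable_of_countable _) hKm).symm
    _ = ∑' k : ℕ, (k : ℝ≥0∞) * P.map K {k} := lintegral_countable' _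
    _ = intensity lam A := by
        rw [tsum_eq_zero_add' ENNReal.summable]
        simp_rw [hstep, ENNReal.tsum_mul_left, hsum, hint]
        simp

omit [IsProbabilityMeasure P] in
theorem indepFun_count (hΦ : IsPoissonProcess P lam Φ) {A B : Set Plane} (hA : MeasurableSet A)
    (hB : MeasurableSet B) (hAB : Disjoint A B) :
    IndepFun (fun ω => (Φ ω).count A) (fun ω => (Φ ω).count B) P := by
  have h := hΦ.indep 2 ![A, B] (by intro i; fin_cases i <;> simpa)
    (by
      intro i j hij
      fin_cases i <;> fin_cases j <;> simp_all [disjoint_comm])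
  exact h.indepFun (i := 0) (j := 1) (by simp)

theorem setLIntegral_count_void (hΦ : IsPoissonProcess P lam Φ) {A B : Set Plane}
    (hA : MeasurableSet A) (hb : Bornology.IsBounded A) (hB : MeasurableSet B)
    (hAB : Disjoint A B) :
    ∫⁻ φ in void B, ((φ.count A : ℕ∞) : ℝ≥0∞) ∂(P.map Φ) =
      intensity lam A * P.map Φ (void B) := by
  have hv := measurableSet_void hB
  have hcA : Measurable fun φ : Config => ((φ.count A : ℕ∞) : ℝ≥0∞) :=
    (measurable_of_countable _).comp (measurable_count hA)
  rw [setLIntegral_map hv hcA hΦ.measurable, Measure.map_apply hΦ.measurable hv,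
    ← lintegral_indicator (hΦ.measurable hv), ← hΦ.lintegral_count hA hb,
    ← lintegral_indicator_one (hΦ.measurable hv)]
  have hind : IndepFun (fun ω => (((Φ ω).count A : ℕ∞) : ℝ≥0∞))
      ((Φ ⁻¹' void B).indicator (1 : Ω → ℝ≥0∞)) P := by
    have h := (hΦ.indepFun_count hA hB hAB).comp
      (φ := fun k : ℕ∞ => (k : ℝ≥0∞)) (ψ := fun k : ℕ∞ => if k = 0 then (1 : ℝ≥0∞) else 0)
      (measurable_of_countable _) (measurable_of_countable _)
    have h2 : (Φ ⁻¹' void B).indicator (1 : Ω → ℝ≥0∞) =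
        (fun k : ℕ∞ => if k = 0 then (1 : ℝ≥0∞) else 0) ∘ fun ω => (Φ ω).count B := by
      ext ω
      simp [Set.indicator_apply, void]
    rw [h2]
    exact h
  have hmul := lintegral_mul_eq_lintegral_mul_lintegral_of_indepFun (hcA.comp hΦ.measurable)
    (measurable_one.indicator (hΦ.measurable hv)) hind
  simp only [Function.comp_apply] at hmul
  rw [← hmul]
  refine lintegral_congr fun ω => ?_
  by_cases h : ω ∈ Φ ⁻¹' void B
  · simp [Set.indicator_of_mem h]
  · simp [Set.indicator_of_notMem h]

/-- Mecke's formula, as an identity of measures. -/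
theorem map_swap_compProd (hΦ : IsPoissonProcess P lam Φ) :
    ((P.map Φ) ⊗ₘ atomKernel).map Prod.swap =
      ((intensity lam).prod (P.map Φ)).map fun z => (z.1, cons z.1 z.2) := by
  have : IsProbabilityMeasure (P.map Φ) :=
    Measure.isProbabilityMeasure_map hΦ.measurable.aemeasurable
  have hcons : Measurable fun z : Plane × Config => (z.1, cons z.1 z.2) :=
    measurable_fst.prodMk (measurable_cons measurable_fst measurable_snd)
  -- If `B` is void, the atoms in `A` are those in `A \ B`, whose number is independent of the void
  -- event. On the other side, adding `x` leaves `B` void exactly when `x ∉ B` and `B` was already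
  -- void.
  have key : ∀ A B, MeasurableSet A → Bornology.IsBounded A → MeasurableSet B →
      ((P.map Φ) ⊗ₘ atomKernel).map Prod.swap (A ×ˢ void B) =
        intensity lam (A \ B) * P.map Φ (void B) ∧
      (((intensity lam).prod (P.map Φ)).map fun z => (z.1, cons z.1 z.2)) (A ×ˢ void B) =
        intensity lam (A \ B) * P.map Φ (void B) := by
    intro A B hA hb hB
    have hv := measurableSet_void hB
    constructor
    · rw [Measure.map_apply measurable_swap (hA.prod hv),
        Measure.compProd_apply (measurable_swap (hA.prod hv)),
        ← hΦ.setLIntegral_count_void (hA.diff hB) (hb.subset Set.sdiff_subset) hB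
          Set.disjoint_sdiff_left,
        ← lintegral_indicator hv]
      congr 1
      ext φ
      by_cases h : φ ∈ void B
      · have hs : Prod.mk φ ⁻¹' (Prod.swap ⁻¹' (A ×ˢ void B)) = A := by
          ext x; simp [h]
        rw [hs, Set.indicator_of_mem h, atomKernel_apply _ hA]
        have hAB : φ.atoms ∩ A = φ.atoms ∩ (A \ B) := by
          rw [mem_void, Set.disjoint_left] at h
          ext x
          exact ⟨fun hx => ⟨hx.1, hx.2, h hx.1⟩, fun hx => ⟨hx.1, hx.2.1⟩⟩
        rw [count, count, hAB]
      · have hs : Prod.mk φ ⁻¹' (Prod.swap ⁻¹' (A ×ˢ void B)) = ∅ := by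
          ext x; simp [h]
        rw [hs, Set.indicator_of_notMem h, measure_empty]
    · rw [Measure.map_apply hcons (hA.prod hv), ← Measure.prod_prod]
      congr 1
      ext z
      simp only [Set.mem_preimage, Set.mem_prod, cons_mem_void, Set.mem_sdiff]
      tauto
  -- Products `A ×ˢ void B` form a generating π-system; the shells, which are bounded, provide the
  -- cover by sets of finite mass.
  refine Measure.ext_of_generateFrom_of_cover
    (S := Set.image2 (· ×ˢ ·) {A : Set Plane | MeasurableSet A} voidEvents)
    (T := Set.range fun n => shell n ×ˢ (Set.univ : Set Config)) ?_ (Set.countable_range _)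
    (MeasurableSpace.isPiSystem_measurableSet.prod isPiSystem_voidEvents) ?_ ?_ ?_ ?_
  · have huniv : (Set.univ : Set Config) = void ∅ := by
      ext φ; simp [mem_void]
    have h1 : IsCountablySpanning {A : Set Plane | MeasurableSet A} :=
      ⟨fun _ => Set.univ, fun _ => (MeasurableSet.univ : MeasurableSet (Set.univ : Set Plane)),
        Set.iUnion_const _⟩
    have h2 : IsCountablySpanning voidEvents :=
      ⟨fun _ => Set.univ, fun _ => ⟨∅, MeasurableSet.empty, huniv.symm⟩, Set.iUnion_const _⟩
    rw [← generateFrom_prod_eq h1 h2, MeasurableSpace.generateFrom_measurableSet,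
      ← generateFrom_voidEvents]
  · rw [Set.sUnion_range, ← Set.iUnion_prod_const, iUnion_shell, Set.univ_prod_univ]
  all_goals
    have huniv : (Set.univ : Set Config) = void ∅ := by
      ext φ; simp [mem_void]
  · rintro _ ⟨n, rfl⟩
    beta_reduce
    rw [huniv, (key _ ∅ (measurableSet_shell n) (isBounded_shell n) MeasurableSet.empty).1]
    refine ENNReal.mul_ne_top ?_ (measure_ne_top _ _)
    rw [Set.sdiff_empty]
    simp only [intensity, Measure.smul_apply, smul_eq_mul]
    exact ENNReal.mul_ne_top ENNReal.coe_ne_top (isBounded_shell n).measure_lt_top.ne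
  · rintro _ ⟨n, rfl⟩ _ ⟨A, hA, _, ⟨B, hB, rfl⟩, rfl⟩
    beta_reduce
    rw [Set.prod_inter_prod, Set.inter_univ]
    have := key (A ∩ shell n) B (MeasurableSet.inter hA (measurableSet_shell n))
      ((isBounded_shell n).subset Set.inter_subset_right) hB
    rw [this.1, this.2]
  · rintro _ ⟨n, rfl⟩
    beta_reduce
    rw [huniv]
    have := key _ ∅ (measurableSet_shell n) (isBounded_shell n) MeasurableSet.empty
    rw [this.1, this.2]

/-- Mecke's formula. -/
theorem lintegral_lintegral_atomKernel (hΦ : IsPoissonProcess P lam Φ)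
    {F : Plane → Config → ℝ≥0∞} (hF : Measurable (Function.uncurry F)) :
    ∫⁻ φ, ∫⁻ x, F x φ ∂(atomKernel φ) ∂(P.map Φ) =
      ∫⁻ x, ∫⁻ φ, F x (cons x φ) ∂(P.map Φ) ∂(intensity lam) := by
  have : IsProbabilityMeasure (P.map Φ) :=
    Measure.isProbabilityMeasure_map hΦ.measurable.aemeasurable
  have hcons : Measurable fun z : Plane × Config => (z.1, cons z.1 z.2) :=
    measurable_fst.prodMk (measurable_cons measurable_fst measurable_snd)
  have h := congrArg (fun μ => ∫⁻ z, Function.uncurry F z ∂μ) hΦ.map_swap_compProd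
  beta_reduce at h
  rw [lintegral_map hF measurable_swap, lintegral_map hF hcons,
    Measure.lintegral_compProd (f := fun z => Function.uncurry F z.swap)
      (hF.comp measurable_swap),
    lintegral_prod (fun z => Function.uncurry F (z.1, cons z.1 z.2))
      (hF.comp hcons).aemeasurable] at h
  exact h

omit [IsProbabilityMeasure P] in
theorem law_void (hΦ : IsPoissonProcess P lam Φ) {B : Set Plane} (hB : MeasurableSet B)
    (hfin : volume B ≠ ∞) :
    P.map Φ (void B) = ENNReal.ofReal (Real.exp (-(lam * (volume B).toReal))) := by
  rw [Measure.map_apply hΦ.measurable (measurableSet_void hB)]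
  have h := hΦ.poisson B hB hfin 0
  simp only [Nat.cast_zero, pow_zero, mul_one, Nat.factorial_zero, Nat.cast_one, div_one] at h
  exact h

end IsPoissonProcess

/-! ### Area of the lens and of the exclusion region -/

theorem hasDerivAt_half_segment {x : ℝ} (h1 : -1 < x) (h2 : x < 1) :
    HasDerivAt (fun t => (t * √(1 - t ^ 2) + Real.arcsin t) / 2) (√(1 - x ^ 2)) x := by
  have hpos : 0 < 1 - x ^ 2 := by nlinarith
  have hs : HasDerivAt (fun t : ℝ => √(1 - t ^ 2)) (-(2 * x) / (2 * √(1 - x ^ 2))) x := by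
    have h := ((hasDerivAt_pow 2 x).const_sub 1).sqrt hpos.ne'
    simpa using h
  have h := (((hasDerivAt_id x).mul hs).add (Real.hasDerivAt_arcsin h1.ne' h2.ne)).div_const 2
  refine h.congr_deriv ?_
  have hne : √(1 - x ^ 2) ≠ 0 := (Real.sqrt_pos.2 hpos).ne'
  have hsq : √(1 - x ^ 2) ^ 2 = 1 - x ^ 2 := Real.sq_sqrt hpos.le
  simp only [id]
  field_simp
  nlinarith

theorem integral_sqrt_one_sub_sq :
    ∫ t in (1 / 2 : ℝ)..1, √(1 - t ^ 2) = Real.pi / 6 - √3 / 8 := by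
  rw [intervalIntegral.integral_eq_sub_of_hasDerivAt_of_le
    (f := fun t => (t * √(1 - t ^ 2) + Real.arcsin t) / 2) (by norm_num)]
  · have h34 : √(1 - (1 / 2 : ℝ) ^ 2) = √3 / 2 := by
      rw [show (1 - (1 / 2 : ℝ) ^ 2) = 3 / 2 ^ 2 by norm_num, Real.sqrt_div (by norm_num),
        Real.sqrt_sq (by norm_num)]
    have hasin : Real.arcsin (1 / 2) = Real.pi / 6 := by
      rw [← Real.sin_pi_div_six, Real.arcsin_sin] <;> linarith [Real.pi_pos]
    rw [h34, hasin, Real.arcsin_one]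
    norm_num
    ring
  · exact Continuous.continuousOn (by fun_prop)
  · intro x hx
    exact hasDerivAt_half_segment (by linarith [hx.1]) hx.2
  · exact Continuous.intervalIntegrable (by fun_prop) _ _

/-- Half the height of the vertical section at abscissa `a` of the lens cut out by the unit discs
centred at `(0, 0)` and `(1, 0)`. -/
noncomputable def lensHeight (a : ℝ) : ℝ := √(min (1 - a ^ 2) (1 - (1 - a) ^ 2))

theorem continuous_lensHeight : Continuous lensHeight := by
  unfold lensHeight
  fun_prop

theorem integral_lensHeight : ∫ a in (0 : ℝ)..1, lensHeight a = Real.pi / 3 - √3 / 4 := by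
  have hi : ∀ a b, IntervalIntegrable lensHeight volume a b := fun a b =>
    continuous_lensHeight.intervalIntegrable a b
  have h2 : ∫ a in (1 / 2 : ℝ)..1, lensHeight a = Real.pi / 6 - √3 / 8 := by
    rw [← integral_sqrt_one_sub_sq]
    refine intervalIntegral.integral_congr fun a ha => ?_
    rw [Set.uIcc_of_le (by norm_num)] at ha
    simp only [lensHeight]
    rw [min_eq_left (by nlinarith [ha.1])]
  have h1 : ∫ a in (0 : ℝ)..(1 / 2), lensHeight a = Real.pi / 6 - √3 / 8 := by
    rw [← h2]
    -- The reflection `a ↦ 1 - a` exchanges the two discs, hence the two halves of the lens.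
    have h := intervalIntegral.integral_comp_sub_left (a := 1 / 2) (b := 1) lensHeight 1
    rw [sub_self, show (1 : ℝ) - 1 / 2 = 1 / 2 by norm_num] at h
    rw [← h]
    refine intervalIntegral.integral_congr fun a _ => ?_
    simp only [lensHeight]
    rw [min_comm]
    ring_nf
  rw [← intervalIntegral.integral_add_adjacent_intervals (hi 0 (1 / 2)) (hi _ _), h1, h2]
  ring

theorem lens_section {a b : ℝ} :
    a ^ 2 + b ^ 2 < 1 ∧ (a - 1) ^ 2 + b ^ 2 < 1 ↔
      (a, b) ∈ regionBetween (fun a => -lensHeight a) lensHeight (Set.Ioo 0 1) := by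
  simp only [regionBetween, Set.mem_ofPred_eq, Set.mem_Ioo, ← abs_lt, lensHeight]
  rw [Real.lt_sqrt (abs_nonneg b), sq_abs, lt_min_iff]
  constructor
  · rintro ⟨h1, h2⟩
    exact ⟨⟨by nlinarith, by nlinarith⟩, by linarith, by nlinarith⟩
  · rintro ⟨-, h1, h2⟩
    exact ⟨by linarith, by nlinarith⟩

theorem pi_mul_gammaConst : Real.pi * gammaConst = 2 * Real.pi / 3 - √3 / 2 := by
  rw [gammaConst]
  field_simp [Real.pi_ne_zero]

theorem gammaConst_pos : 0 < gammaConst := by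
  have h3 : √3 < 2 := by
    rw [Real.sqrt_lt' (by norm_num)]; norm_num
  have := Real.pi_gt_three
  have h : 0 < Real.pi * gammaConst := by rw [pi_mul_gammaConst]; linarith
  exact (pos_iff_pos_of_mul_pos h).1 Real.pi_pos

theorem gammaConst_lt_one : gammaConst < 1 := by
  rw [gammaConst]
  have : 0 < √3 / (2 * Real.pi) := by positivity
  linarith

theorem volume_lens :
    volume (Metric.ball (0 : Plane) 1 ∩ Metric.ball (EuclideanSpace.single 0 1 : Plane) 1) =
      ENNReal.ofReal (Real.pi * gammaConst) := by
  let T : Plane → ℝ × ℝ := fun z => (z 0, z 1)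
  have hT : MeasurePreserving T volume volume :=
    (volume_preserving_finTwoArrow ℝ).comp (PiLp.volume_preserving_ofLp (Fin 2))
  have hset : Metric.ball (0 : Plane) 1 ∩ Metric.ball (EuclideanSpace.single 0 1 : Plane) 1 =
      T ⁻¹' regionBetween (fun a => -lensHeight a) lensHeight (Set.Ioo 0 1) := by
    ext z
    rw [Set.mem_preimage, ← lens_section, Set.mem_inter_iff, Metric.mem_ball, Metric.mem_ball,
      EuclideanSpace.dist_eq, EuclideanSpace.dist_eq, Real.sqrt_lt' one_pos,
      Real.sqrt_lt' one_pos]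
    simp [Real.dist_eq, sq_abs]
  have hm : MeasurableSet (regionBetween (fun a => -lensHeight a) lensHeight (Set.Ioo 0 1)) :=
    measurableSet_regionBetween continuous_lensHeight.neg.measurable
      continuous_lensHeight.measurable measurableSet_Ioo
  have hi : IntegrableOn lensHeight (Set.Ioo 0 1) :=
    (continuous_lensHeight.integrableOn_Icc (a := 0) (b := 1)).mono_set Set.Ioo_subset_Icc_self
  rw [hset, hT.measure_preimage hm.nullMeasurableSet, Measure.volume_eq_prod,
    volume_regionBetween_eq_integral (f := fun a => -lensHeight a) hi.neg hi measurableSet_Ioo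
      fun a _ => neg_le_self (Real.sqrt_nonneg _)]
  congr 1
  have : ∀ a, (lensHeight - fun a => -lensHeight a) a = 2 * lensHeight a := fun a => by
    simp only [Pi.sub_apply]; ring
  simp_rw [this]
  rw [← integral_Ioc_eq_integral_Ioo, ← intervalIntegral.integral_of_le zero_le_one,
    intervalIntegral.integral_const_mul, integral_lensHeight, pi_mul_gammaConst]
  ring

-- Translation, a linear isometry and scaling by `r` reduce to the unit lens; scaling contributes
-- the factor `r ^ 2`.
open Pointwise in
theorem volume_ball_inter_ball (x y : Plane) :
    volume (Metric.ball x ‖x - y‖ ∩ Metric.ball y ‖x - y‖) =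
      ENNReal.ofReal (Real.pi * ‖x - y‖ ^ 2 * gammaConst) := by
  rcases eq_or_ne x y with rfl | hxy
  · simp
  set r := ‖x - y‖ with hr
  have hr0 : 0 < r := norm_pos_iff.2 (sub_ne_zero.2 hxy)
  set e : Plane := EuclideanSpace.single 0 1 with he
  have h1 : (fun z => x + z) ⁻¹' (Metric.ball x r ∩ Metric.ball y r) =
      Metric.ball 0 r ∩ Metric.ball (y - x) r := by
    ext z
    simp only [Set.mem_preimage, Set.mem_inter_iff, mem_ball_iff_norm, sub_zero,
      add_sub_cancel_left]
    rw [show x + z - y = z - (y - x) by abel]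
  have hnorm : ‖r • e‖ = ‖y - x‖ := by
    rw [norm_smul, he, PiLp.norm_single, norm_sub_rev y x, ← hr]
    simp [hr0.le]
  -- Two vectors of equal norm are exchanged by the reflection in the hyperplane orthogonal to their
  -- difference.
  let R : Plane ≃ₗᵢ[ℝ] Plane := (Submodule.span ℝ {r • e - (y - x)})ᗮ.reflection
  have hR : R (r • e) = y - x := Submodule.reflection_sub hnorm
  have h2 : R ⁻¹' (Metric.ball 0 r ∩ Metric.ball (y - x) r) =
      Metric.ball 0 r ∩ Metric.ball (r • e) r := by
    rw [Set.preimage_inter, ← hR, R.preimage_ball, R.preimage_ball]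
    simp
  have h3 : Metric.ball 0 r ∩ Metric.ball (r • e) r =
      r • (Metric.ball (0 : Plane) 1 ∩ Metric.ball e 1) := by
    rw [Set.smul_set_inter₀ hr0.ne', smul_ball hr0.ne', smul_ball hr0.ne']
    simp [abs_of_pos hr0]
  rw [← measure_preimage_add volume x, h1,
    ← R.measurePreserving.measure_preimage
      (Metric.isOpen_ball.inter Metric.isOpen_ball).measurableSet.nullMeasurableSet, h2, h3,
    Measure.addHaar_smul, volume_lens, ← ENNReal.ofReal_mul (abs_nonneg _)]
  congr 1
  rw [finrank_euclideanSpace_fin, abs_of_pos (by positivity)]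
  ring

/-- The region which must not contain a third atom when `x` and `y` are mutually nearest
neighbours. -/
def exclusionRegion (x y : Plane) : Set Plane :=
  Metric.ball x ‖x - y‖ ∪ Metric.ball y ‖x - y‖

theorem measurableSet_exclusionRegion (x y : Plane) : MeasurableSet (exclusionRegion x y) :=
  (Metric.isOpen_ball.union Metric.isOpen_ball).measurableSet

theorem volume_exclusionRegion (x y : Plane) :
    volume (exclusionRegion x y) = ENNReal.ofReal (Real.pi * ‖x - y‖ ^ 2 * (2 - gammaConst)) := by
  have h := measure_union_add_inter (μ := volume) (Metric.ball x ‖x - y‖)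
    (Metric.isOpen_ball (x := y) (ε := ‖x - y‖)).measurableSet
  rw [volume_ball_inter_ball, EuclideanSpace.volume_ball_fin_two,
    EuclideanSpace.volume_ball_fin_two, ← ENNReal.ofReal_pow (norm_nonneg _),
    ← ENNReal.ofReal_mul (by positivity), ← ENNReal.ofReal_add (by positivity) (by positivity)] at h
  rw [exclusionRegion, ENNReal.eq_sub_of_add_eq ENNReal.ofReal_ne_top h,
    ← ENNReal.ofReal_sub _ (by have := gammaConst_pos; positivity)]
  congr 1
  ring

theorem lintegral_exp_neg_sq_norm_sub {lam : ℝ≥0} (hlam : 0 < lam) (x : Plane) :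
    ∫⁻ y, ENNReal.ofReal (Real.exp (-(lam * Real.pi * ‖x - y‖ ^ 2 * (2 - gammaConst))))
      ∂(intensity lam) = ENNReal.ofReal deltaConst := by
  have hg : 0 < 2 - gammaConst := by linarith [gammaConst_lt_one]
  have hl : (0 : ℝ) < lam := hlam
  set b : ℝ := lam * Real.pi * (2 - gammaConst) with hb
  have hb0 : 0 < b := by have := Real.pi_pos; positivity
  have hint : ∫ v : Plane, Real.exp (-b * ‖v‖ ^ 2) = Real.pi / b := by
    rw [GaussianFourier.integral_rexp_neg_mul_sq_norm hb0, finrank_euclideanSpace_fin]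
    norm_num
  -- A non-integrable function has integral zero by convention, so a nonzero value certifies
  -- integrability.
  have hne : ∫ v : Plane, Real.exp (-b * ‖v‖ ^ 2) ≠ 0 := by
    rw [hint]; have := Real.pi_pos; positivity
  have hI : Integrable fun v : Plane => Real.exp (-b * ‖v‖ ^ 2) :=
    not_imp_comm.1 integral_undef hne
  have h1 : ∫⁻ y : Plane, ENNReal.ofReal
      (Real.exp (-(lam * Real.pi * ‖x - y‖ ^ 2 * (2 - gammaConst)))) =
      ENNReal.ofReal (Real.pi / b) := by
    rw [← hint, ofReal_integral_eq_lintegral_ofReal hI (ae_of_all _ fun v => (Real.exp_pos _).le),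
      ← lintegral_sub_left_eq_self _ x]
    refine lintegral_congr fun y => ?_
    rw [hb, sub_sub_cancel]
    ring_nf
  rw [intensity, lintegral_smul_measure, h1, smul_eq_mul, ← ENNReal.ofReal_coe_nnreal,
    ← ENNReal.ofReal_mul hl.le, hb, deltaConst]
  congr 1
  have := Real.pi_pos
  field_simp

/-! ### Neighbour probabilities for added points -/

namespace Config

/-- The discs are open because ties are allowed in the nearest neighbour relation. The points `x`
and `y` are removed since `φ` may already contain them, which does no harm; this leaves the area
unchanged. -/
theorem MNNR_cons_cons_iff {φ : Config} {x y : Plane} (hxy : x ≠ y) :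
    (cons x (cons y φ)).MNNR x y ↔ φ ∈ void (exclusionRegion x y \ {x, y}) := by
  simp only [MNNR, NNR, cons, mem_void, Set.disjoint_left, exclusionRegion, Set.mem_insert_iff,
    Set.mem_sdiff, Set.mem_union, mem_ball_iff_norm', Set.mem_singleton_iff, not_and, not_not,
    norm_sub_rev y x]
  constructor
  · rintro ⟨⟨-, -, -, h1⟩, -, -, -, h2⟩ z hz hd
    by_contra hne
    rw [not_or] at hne
    rcases hd with hd | hd
    · exact (h1 z (.inr (.inr hz)) hne.1).not_gt hd
    · exact (h2 z (.inr (.inr hz)) hne.2).not_gt hd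
  · intro h
    have hfar : ∀ z ∈ φ.atoms, z ≠ x → z ≠ y → ‖x - y‖ ≤ ‖x - z‖ ∧ ‖x - y‖ ≤ ‖y - z‖ := by
      intro z hz hzx hzy
      by_contra hc
      rw [not_and_or, not_le, not_le] at hc
      exact (h hz hc).elim hzx hzy
    refine ⟨⟨by simp, by simp, hxy, ?_⟩, by simp, by simp, hxy.symm, ?_⟩
    · rintro z (rfl | rfl | hz) hzx
      · exact absurd rfl hzx
      · exact le_rfl
      · by_cases hzy : z = y
        · rw [hzy]
        · exact (hfar z hz hzx hzy).1
    · rintro z (rfl | rfl | hz) hzy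
      · rw [norm_sub_rev]
      · exact absurd rfl hzy
      · by_cases hzx : z = x
        · rw [hzx, norm_sub_rev]
        · exact (hfar z hz hzx hzy).2

theorem lintegral_atomKernel_cons (φ : Config) {x : Plane} {f : Plane → ℝ≥0∞} (hf : f x = 0) :
    ∫⁻ y, f y ∂(atomKernel (cons x φ)) = ∫⁻ y, f y ∂(atomKernel φ) := by
  rw [lintegral_atomKernel, lintegral_atomKernel, tsum_subtype, tsum_subtype]
  refine tsum_congr fun y => ?_
  rcases eq_or_ne y x with rfl | hy
  · rw [Set.indicator_apply_eq_zero.2 fun _ => hf, Set.indicator_apply_eq_zero.2 fun _ => hf]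
  · by_cases hyφ : y ∈ φ.atoms
    · rw [Set.indicator_of_mem hyφ, Set.indicator_of_mem (s := (cons x φ).atoms) (.inr hyφ)]
    · rw [Set.indicator_of_notMem hyφ,
        Set.indicator_of_notMem (s := (cons x φ).atoms) fun h => h.elim hy hyφ]

end Config

namespace IsPoissonProcess

variable {Ω : Type*} [MeasurableSpace Ω] {P : Measure Ω} [IsProbabilityMeasure P]
  {lam : ℝ≥0} {Φ : Ω → Config}

theorem isProbabilityMeasure_law (hΦ : IsPoissonProcess P lam Φ) :
    IsProbabilityMeasure (P.map Φ) :=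
  Measure.isProbabilityMeasure_map hΦ.measurable.aemeasurable

omit [IsProbabilityMeasure P] in
theorem law_MNNR_cons_cons (hΦ : IsPoissonProcess P lam Φ) {x y : Plane} (hxy : x ≠ y) :
    P.map Φ {φ | (cons x (cons y φ)).MNNR x y} =
      ENNReal.ofReal (Real.exp (-(lam * Real.pi * ‖x - y‖ ^ 2 * (2 - gammaConst)))) := by
  have hvol : volume (exclusionRegion x y \ {x, y}) =
      ENNReal.ofReal (Real.pi * ‖x - y‖ ^ 2 * (2 - gammaConst)) := by
    rw [measure_sdiff_null ((Set.toFinite {x, y}).measure_zero _), volume_exclusionRegion]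
  have hset : {φ : Config | (cons x (cons y φ)).MNNR x y} =
      void (exclusionRegion x y \ {x, y}) := by
    ext φ
    exact MNNR_cons_cons_iff hxy
  have hg : 0 ≤ 2 - gammaConst := by linarith [gammaConst_lt_one]
  have := Real.pi_pos
  rw [hset, hΦ.law_void ((measurableSet_exclusionRegion x y).diff
    (Set.toFinite {x, y}).measurableSet) (by rw [hvol]; exact ENNReal.ofReal_ne_top), hvol,
    ENNReal.toReal_ofReal (by positivity)]
  congr 3
  ring

open Classical in
theorem lintegral_lintegral_MNNR_cons (hΦ : IsPoissonProcess P lam Φ) (x : Plane)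
    {h : Plane → ℝ≥0∞} (hh : Measurable h) :
    ∫⁻ φ, ∫⁻ y, (if (cons x φ).MNNR x y then h y else 0) ∂(atomKernel φ) ∂(P.map Φ) =
      ∫⁻ y, h y *
        ENNReal.ofReal (Real.exp (-(lam * Real.pi * ‖x - y‖ ^ 2 * (2 - gammaConst))))
        ∂(intensity lam) := by
  rw [hΦ.lintegral_lintegral_atomKernel (F := fun y φ => if (cons x φ).MNNR x y then h y else 0)
    (Measurable.ite (measurableSet_MNNR (measurable_cons measurable_const measurable_snd)
      measurable_const measurable_fst) (hh.comp measurable_fst) measurable_const)]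
  -- The probability of the mutual relation is known only for distinct points; the diagonal is null.
  have hne : ∀ᵐ y ∂(intensity lam), y ≠ x := by
    rw [ae_iff]
    simp [intensity]
  refine lintegral_congr_ae (hne.mono fun y hy => ?_)
  have hm : MeasurableSet {φ : Config | (cons x (cons y φ)).MNNR x y} :=
    measurableSet_MNNR (measurable_cons measurable_const
      (measurable_cons measurable_const measurable_id)) measurable_const measurable_const
  dsimp only
  rw [← hΦ.law_MNNR_cons_cons hy.symm, ← lintegral_indicator_const hm]
  rfl

open Classical in
/-- Mean of a sum over the ordered pairs of mutually nearest neighbours. -/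
theorem lintegral_lintegral_MNNR (hΦ : IsPoissonProcess P lam Φ)
    {g : Plane → Plane → ℝ≥0∞} (hg : Measurable (Function.uncurry g)) :
    ∫⁻ φ, ∫⁻ x, ∫⁻ y, (if φ.MNNR x y then g x y else 0) ∂(atomKernel φ) ∂(atomKernel φ)
        ∂(P.map Φ) =
      ∫⁻ x, ∫⁻ y, g x y *
        ENNReal.ofReal (Real.exp (-(lam * Real.pi * ‖x - y‖ ^ 2 * (2 - gammaConst))))
        ∂(intensity lam) ∂(intensity lam) := by
  have hF : Measurable (Function.uncurry fun (x : Plane) (φ : Config) =>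
      ∫⁻ y, (if φ.MNNR x y then g x y else 0) ∂(atomKernel φ)) := by
    refine measurable_lintegral_atomKernel (α := Plane × Config) (F := Prod.snd) measurable_snd
      (f := fun a y => if a.2.MNNR a.1 y then g a.1 y else 0) ?_
    refine Measurable.ite (measurableSet_MNNR (by fun_prop) (by fun_prop) (by fun_prop)) ?_
      measurable_const
    exact hg.comp ((measurable_fst.comp measurable_fst).prodMk measurable_snd)
  rw [hΦ.lintegral_lintegral_atomKernel hF]
  refine lintegral_congr fun x => ?_
  -- Mecke's formula has added `x`. As `x` is never its own neighbour, the inner sum may run over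
  -- the atoms of `φ` alone, which permits a second application.
  rw [← hΦ.lintegral_lintegral_MNNR_cons x (h := g x) (hg.comp measurable_prodMk_left)]
  refine lintegral_congr fun φ => lintegral_atomKernel_cons φ ?_
  exact if_neg fun h => h.1.2.2.1 rfl

open Classical in
/-- Almost surely no two atoms are at the same distance of a given point. -/
theorem ae_injOn_norm_sub (hΦ : IsPoissonProcess P lam Φ) (x : Plane) :
    ∀ᵐ φ ∂(P.map Φ), ∀ y ∈ φ.atoms, ∀ z ∈ φ.atoms, ‖x - z‖ = ‖x - y‖ → z = y := by
  have := hΦ.isProbabilityMeasure_law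
  let e : Plane → Plane → ℝ≥0∞ := fun y z => if z ≠ y ∧ ‖x - z‖ = ‖x - y‖ then 1 else 0
  have he : Measurable (Function.uncurry e) := by
    have h1 : MeasurableSet {w : Plane × Plane | w.2 = w.1} :=
      measurableSet_eq_fun measurable_snd measurable_fst
    have h2 : MeasurableSet {w : Plane × Plane | ‖x - w.2‖ = ‖x - w.1‖} :=
      measurableSet_eq_fun (by fun_prop) (by fun_prop)
    exact Measurable.ite (h1.compl.inter h2) measurable_const measurable_const
  have hF : Measurable (Function.uncurry fun (y : Plane) (φ : Config) =>
      ∫⁻ z, e y z ∂(atomKernel φ)) :=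
    measurable_lintegral_atomKernel (α := Plane × Config) (F := Prod.snd) measurable_snd
      (f := fun a z => e a.1 z) (he.comp ((measurable_fst.comp measurable_fst).prodMk
        measurable_snd))
  -- Two uses of Mecke's formula reduce the expected number of equidistant pairs to an integral over
  -- circles centred at `x`, which have area zero.
  have hzero : ∫⁻ φ, ∫⁻ y, ∫⁻ z, e y z ∂(atomKernel φ) ∂(atomKernel φ) ∂(P.map Φ) = 0 := by
    rw [hΦ.lintegral_lintegral_atomKernel hF]
    refine (lintegral_congr fun y => ?_).trans lintegral_zero
    rw [lintegral_congr fun φ => lintegral_atomKernel_cons φ (f := e y) (x := y) (by simp [e]),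
      hΦ.lintegral_lintegral_atomKernel (F := fun z _ => e y z)
        (he.comp (measurable_const.prodMk measurable_fst))]
    have hs : ∀ᵐ z ∂(intensity lam), z ∉ Metric.sphere x ‖x - y‖ :=
      Measure.ae_smul_measure
        (measure_eq_zero_iff_ae_notMem.1 (Measure.addHaar_sphere volume x _)) _
    refine (lintegral_congr_ae (hs.mono fun z hz => ?_)).trans lintegral_zero
    have : e y z = 0 := if_neg fun h => hz (by rw [Metric.mem_sphere, dist_comm, dist_eq_norm, h.2])
    simp [this]
  have hmeas : Measurable fun φ : Config =>
      ∫⁻ y, ∫⁻ z, e y z ∂(atomKernel φ) ∂(atomKernel φ) :=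
    measurable_lintegral_atomKernel (F := id) measurable_id
      (f := fun φ y => ∫⁻ z, e y z ∂(atomKernel φ)) (hF.comp measurable_swap)
  refine ((lintegral_eq_zero_iff hmeas).1 hzero).mono fun φ hφ y hy z hz h => ?_
  simp only [Pi.zero_apply, lintegral_atomKernel, ENNReal.tsum_eq_zero] at hφ
  by_contra hne
  have := hφ ⟨y, hy⟩ ⟨z, hz⟩
  simp only [e] at this
  rw [if_pos ⟨hne, h⟩] at this
  exact one_ne_zero this

-- Two mutual neighbours of `x` would both be nearest to `x`, hence equidistant from it, which
-- almost surely forces them to be equal. The indicator of cooperation is then the number of mutual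
-- neighbours, whose mean is the Gaussian integral.
open Classical in
theorem law_cooperating_cons (hΦ : IsPoissonProcess P lam Φ) (hlam : 0 < lam) (x : Plane) :
    P.map Φ {φ | x ∈ (cons x φ).cooperating} = ENNReal.ofReal deltaConst := by
  have hm : MeasurableSet {φ : Config | x ∈ (cons x φ).cooperating} :=
    measurableSet_cooperating (measurable_cons measurable_const measurable_id) measurable_const
  have h := hΦ.lintegral_lintegral_MNNR_cons x (h := fun _ => 1) measurable_const
  simp only [one_mul] at h
  rw [← lintegral_exp_neg_sq_norm_sub hlam x, ← h, ← lintegral_indicator_one hm]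
  refine lintegral_congr_ae ((hΦ.ae_injOn_norm_sub x).mono fun φ hφ => ?_)
  dsimp only
  rw [lintegral_atomKernel]
  have hmem : ∀ {y}, (cons x φ).MNNR x y → y ∈ φ.atoms := fun h =>
    h.1.2.1.resolve_left h.1.2.2.1.symm
  by_cases hc : x ∈ (cons x φ).cooperating
  · obtain ⟨-, y, -, hy⟩ := hc
    have hc : x ∈ (cons x φ).cooperating := ⟨hy.1.1, y, hy.1.2.1, hy⟩
    rw [Set.indicator_of_mem (by exact hc), tsum_eq_single ⟨y, hmem hy⟩, if_pos hy,
      Pi.one_apply]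
    intro z hz
    refine if_neg fun hzn => hz (Subtype.ext ?_)
    exact hφ y (hmem hy) z z.2 (le_antisymm (hzn.1.2.2.2 y hy.1.2.1 hy.1.2.2.1.symm)
      (hy.1.2.2.2 z hzn.1.2.1 hzn.1.2.2.1.symm))
  · rw [Set.indicator_of_notMem (by exact hc)]
    refine (ENNReal.tsum_eq_zero.2 fun y => if_neg fun hy => hc ?_).symm
    exact ⟨hy.1.1, y, hy.1.2.1, hy⟩

theorem law_singles_cons (hΦ : IsPoissonProcess P lam Φ) (hlam : 0 < lam) (x : Plane) :
    P.map Φ {φ | x ∈ (cons x φ).singles} = ENNReal.ofReal (1 - deltaConst) := by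
  have := hΦ.isProbabilityMeasure_law
  have hm : MeasurableSet {φ : Config | x ∈ (cons x φ).cooperating} :=
    measurableSet_cooperating (measurable_cons measurable_const measurable_id) measurable_const
  have hset : {φ : Config | x ∈ (cons x φ).singles} =
      {φ : Config | x ∈ (cons x φ).cooperating}ᶜ := by
    ext φ
    have : x ∈ (cons x φ).atoms := Set.mem_insert _ _
    simp [mem_singles_iff, this]
  have hδ : 0 ≤ deltaConst := by
    have : 0 < 2 - gammaConst := by linarith [gammaConst_lt_one]
    rw [deltaConst]
    positivity
  rw [hset, prob_compl_eq_one_sub hm, hΦ.law_cooperating_cons hlam, ENNReal.ofReal_sub _ hδ,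
    ENNReal.ofReal_one]

open Classical in
/-- Mean of a sum over the single atoms. -/
theorem lintegral_lintegral_singles (hΦ : IsPoissonProcess P lam Φ) (hlam : 0 < lam)
    {f : Plane → ℝ≥0∞} (hf : Measurable f) :
    ∫⁻ φ, ∫⁻ x, (if x ∈ φ.singles then f x else 0) ∂(atomKernel φ) ∂(P.map Φ) =
      ENNReal.ofReal (1 - deltaConst) * ∫⁻ x, f x ∂(intensity lam) := by
  rw [hΦ.lintegral_lintegral_atomKernel (F := fun x φ => if x ∈ φ.singles then f x else 0)
    (Measurable.ite (measurableSet_singles measurable_snd measurable_fst)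
      (hf.comp measurable_fst) measurable_const), ← lintegral_const_mul _ hf]
  refine lintegral_congr fun x => ?_
  have hm : MeasurableSet {φ : Config | x ∈ (cons x φ).singles} :=
    measurableSet_singles (measurable_cons measurable_const measurable_id) measurable_const
  rw [← hΦ.law_singles_cons hlam x, mul_comm, ← lintegral_indicator_const hm]
  rfl

end IsPoissonProcess

/-! ### Averaging out independent signals -/

theorem lintegral_comp_of_indepFun {Ω β Ω' : Type*} {mΩ : MeasurableSpace Ω} {mβ : MeasurableSpace β}
    {mΩ' : MeasurableSpace Ω'} {P : Measure Ω} [IsProbabilityMeasure P] {Z : Ω → β} {Y : Ω → Ω'}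
    (hZ : Measurable Z) (hY : Measurable Y) (h : IndepFun Z Y P) {G : β → Ω' → ℝ≥0∞}
    (hG : Measurable (Function.uncurry G)) :
    ∫⁻ ω, G (Z ω) (Y ω) ∂P = ∫⁻ b, ∫⁻ ω, G b (Y ω) ∂P ∂(P.map Z) := by
  have : IsProbabilityMeasure (P.map Y) := Measure.isProbabilityMeasure_map hY.aemeasurable
  have h1 : ∫⁻ ω, G (Z ω) (Y ω) ∂P =
      ∫⁻ z, Function.uncurry G z ∂(P.map fun ω => (Z ω, Y ω)) :=
    (lintegral_map hG (hZ.prodMk hY)).symm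
  rw [h1, (indepFun_iff_map_prod_eq_prod_map_map hZ.aemeasurable hY.aemeasurable).1 h,
    lintegral_prod _ hG.aemeasurable]
  exact lintegral_congr fun b => lintegral_map (hG.comp measurable_prodMk_left) hY

theorem measurable_prod_of_le {Ω β : Type*} {𝒢 mΩ : MeasurableSpace Ω} [mβ : MeasurableSpace β]
    (h𝒢 : 𝒢 ≤ mΩ) {G : β × Ω → ℝ≥0∞}
    (hG : @Measurable (β × Ω) ℝ≥0∞ (mβ.prod 𝒢) _ G) : Measurable G :=
  hG.mono (sup_le_sup le_rfl (MeasurableSpace.comap_mono h𝒢)) le_rfl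

/-- Fubini's theorem for a random element `Z` independent of a σ-algebra `𝒢`. -/
theorem lintegral_comp_of_indep {Ω β : Type*} {𝒢 mΩ : MeasurableSpace Ω} [mβ : MeasurableSpace β]
    {P : Measure Ω} [IsProbabilityMeasure P] {Z : Ω → β} (hZ : Measurable Z)
    (h𝒢 : 𝒢 ≤ mΩ)
    (h : Indep 𝒢 (MeasurableSpace.comap Z inferInstance) P) {G : β → Ω → ℝ≥0∞}
    (hG : @Measurable (β × Ω) ℝ≥0∞ (mβ.prod 𝒢) _ (fun z => G z.1 z.2)) :
    Measurable (fun ω => G (Z ω) ω) ∧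
      ∫⁻ ω, G (Z ω) ω ∂P = ∫⁻ b, ∫⁻ ω, G b ω ∂P ∂(P.map Z) := by
  refine ⟨(measurable_prod_of_le h𝒢 hG).comp (hZ.prodMk measurable_id), ?_⟩
  -- The identity, seen as a map into `Ω` with the σ-algebra `𝒢`, is a random element that carries
  -- all the randomness of the field.
  have hid : Indep (MeasurableSpace.comap Z mβ) (MeasurableSpace.comap id 𝒢) P := by
    rw [MeasurableSpace.comap_id]
    exact h.symm
  exact lintegral_comp_of_indepFun (mΩ' := 𝒢) (Y := id) hZ (measurable_id'' h𝒢) hid hG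

section joint
variable {Ω' : Type*} [MeasurableSpace Ω']

open Classical in
theorem measurable_singles_sum {f : Plane → Ω' → ℝ≥0∞}
    (hf : Measurable fun z : Plane × Ω' => f z.1 z.2) :
    Measurable fun z : Config × Ω' =>
      ∫⁻ x, (if x ∈ z.1.singles then f x z.2 else 0) ∂(atomKernel z.1) := by
  refine measurable_lintegral_atomKernel measurable_fst
    (f := fun z x => if x ∈ z.1.singles then f x z.2 else 0) ?_
  exact Measurable.ite (measurableSet_singles (by fun_prop) (by fun_prop))
    (hf.comp (measurable_snd.prodMk (measurable_snd.comp measurable_fst))) measurable_const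

open Classical in
theorem measurable_pairs_sum {g : Plane → Plane → Ω' → ℝ≥0∞}
    (hg : Measurable fun z : (Plane × Plane) × Ω' => g z.1.1 z.1.2 z.2) :
    Measurable fun z : Config × Ω' =>
      ∫⁻ x, ∫⁻ y, (if z.1.MNNR x y then g x y z.2 else 0)
        ∂(atomKernel z.1) ∂(atomKernel z.1) := by
  refine measurable_lintegral_atomKernel measurable_fst
    (f := fun z x => ∫⁻ y, (if z.1.MNNR x y then g x y z.2 else 0) ∂(atomKernel z.1)) ?_
  refine measurable_lintegral_atomKernel (α := (Config × Ω') × Plane)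
    (measurable_fst.comp measurable_fst)
    (f := fun w y => if w.1.1.MNNR w.2 y then g w.2 y w.1.2 else 0) ?_
  refine Measurable.ite (measurableSet_MNNR (by fun_prop) (by fun_prop) (by fun_prop))
    (hg.comp (g := fun z : (Plane × Plane) × Ω' => g z.1.1 z.1.2 z.2)
      (f := fun v : ((Config × Ω') × Plane) × Plane => ((v.1.2, v.2), v.1.1.2)) ?_)
    measurable_const
  fun_prop

end joint

/-! ### Neighbour relations along an enumeration -/

section sequences

/-- The `m`-th term is a nearest neighbour of the `n`-th one in the sequence `p`. -/
def SeqNNR (p : ℕ → Plane) (n m : ℕ) : Prop :=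
  p n ≠ p m ∧ ∀ k, p k ≠ p n → ‖p n - p m‖ ≤ ‖p n - p k‖

/-- The `n`-th and `m`-th terms of the sequence `p` are mutually nearest neighbours. -/
def SeqMNNR (p : ℕ → Plane) (n m : ℕ) : Prop := SeqNNR p n m ∧ SeqNNR p m n

theorem measurableSet_seqNNR (n m : ℕ) : MeasurableSet {p | SeqNNR p n m} := by
  have h1 : ∀ k l : ℕ, MeasurableSet {p : ℕ → Plane | p k = p l} := fun k l =>
    measurableSet_eq_fun (measurable_pi_apply k) (measurable_pi_apply l)
  have h2 : ∀ k, MeasurableSet {p : ℕ → Plane | ‖p n - p m‖ ≤ ‖p n - p k‖} := fun k =>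
    measurableSet_le (by fun_prop) (by fun_prop)
  have : {p | SeqNNR p n m} = {p : ℕ → Plane | p n = p m}ᶜ ∩
      ⋂ k, {p : ℕ → Plane | p k = p n} ∪ {p : ℕ → Plane | ‖p n - p m‖ ≤ ‖p n - p k‖} := by
    ext p
    simp only [SeqNNR, Set.mem_ofPred_eq, Set.mem_inter_iff, Set.mem_compl_iff, Set.mem_iInter,
      Set.mem_union, or_iff_not_imp_left, ne_eq]
  rw [this]
  exact (h1 n m).compl.inter (MeasurableSet.iInter fun k => (h1 k n).union (h2 k))

theorem measurableSet_seqMNNR (n m : ℕ) : MeasurableSet {p | SeqMNNR p n m} :=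
  (measurableSet_seqNNR n m).inter (measurableSet_seqNNR m n)

theorem measurableSet_forall_not_seqMNNR (n : ℕ) :
    MeasurableSet {p | ∀ m, ¬ SeqMNNR p n m} := by
  have : {p | ∀ m, ¬ SeqMNNR p n m} = ⋂ m, {p | SeqMNNR p n m}ᶜ := by
    ext p
    simp
  rw [this]
  exact MeasurableSet.iInter fun m => (measurableSet_seqMNNR n m).compl

section
variable {Ω' : Type*} [MeasurableSpace Ω']

open Classical in
theorem measurable_seqSingles_term {s : Plane → Ω' → ℝ≥0∞}
    (hs : Measurable fun z : Plane × Ω' => s z.1 z.2) (n : ℕ) :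
    Measurable fun z : (ℕ → Plane) × Ω' =>
      if ∀ m, ¬ SeqMNNR z.1 n m then s (z.1 n) z.2 else 0 :=
  Measurable.ite (measurable_fst (measurableSet_forall_not_seqMNNR n))
    (hs.comp (f := fun z : (ℕ → Plane) × Ω' => (z.1 n, z.2)) (by fun_prop)) measurable_const

open Classical in
theorem measurable_seqPairs_term {t : Plane → Plane → Ω' → ℝ≥0∞}
    (ht : Measurable fun z : (Plane × Plane) × Ω' => t z.1.1 z.1.2 z.2) (n m : ℕ) :
    Measurable fun z : (ℕ → Plane) × Ω' =>
      if SeqMNNR z.1 n m then t (z.1 n) (z.1 m) z.2 else 0 :=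
  Measurable.ite (measurable_fst (measurableSet_seqMNNR n m))
    (ht.comp (f := fun z : (ℕ → Plane) × Ω' => ((z.1 n, z.1 m), z.2)) (by fun_prop))
    measurable_const

end

variable {φ : Config} {p : ℕ → Plane}

/-- The attached signals are assumed independent of the sequence `X`, and its range is the set of
atoms only almost surely. Expressing the relation through the list alone makes it an event of the
sequence. -/
theorem NNR_iff_seqNNR (h : Set.range p = φ.atoms) {n m : ℕ} :
    φ.NNR (p n) (p m) ↔ SeqNNR p n m := by
  simp only [NNR, SeqNNR, ← h, Set.mem_range_self, true_and, Set.forall_mem_range]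

theorem MNNR_iff_seqMNNR (h : Set.range p = φ.atoms) {n m : ℕ} :
    φ.MNNR (p n) (p m) ↔ SeqMNNR p n m :=
  and_congr (NNR_iff_seqNNR h) (NNR_iff_seqNNR h)

theorem mem_singles_iff_seqMNNR (h : Set.range p = φ.atoms) {n : ℕ} :
    p n ∈ φ.singles ↔ ∀ m, ¬ SeqMNNR p n m := by
  simp only [singles, Set.mem_ofPred_eq, ← MNNR_iff_seqMNNR h, ← h, Set.mem_range_self, true_and,
    Set.forall_mem_range]

theorem lintegral_atomKernel_of_range (hp : Function.Injective p) (h : Set.range p = φ.atoms)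
    (f : Plane → ℝ≥0∞) : ∫⁻ x, f x ∂(atomKernel φ) = ∑' n, f (p n) := by
  rw [lintegral_atomKernel, ← h, tsum_range f hp]

end sequences

/-! ### The four mean formulas -/

namespace IsPoissonProcess

variable {Ω : Type*} [mΩ : MeasurableSpace Ω] {P : Measure Ω} [IsProbabilityMeasure P]
  {lam : ℝ≥0} {Φ : Ω → Config}

theorem interference₁_of_isIndepField (hΦ : IsPoissonProcess P lam Φ) (hlam : 0 < lam)
    {f : Plane → Ω → ℝ≥0∞} (hf : IsIndepField P Φ f) :
    AEMeasurable (fun ω => (Φ ω).interference₁ fun x => f x ω) P ∧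
      ∫⁻ ω, (Φ ω).interference₁ (fun x => f x ω) ∂P = singlesFormula P lam f := by
  classical
  obtain ⟨hm, h1, h2⟩ : (Measurable fun z : Plane × Ω => f z.1 z.2) ∧
      (Measurable fun ω =>
        ∫⁻ x, (if x ∈ (Φ ω).singles then f x ω else 0) ∂(atomKernel (Φ ω))) ∧
      ∫⁻ ω, ∫⁻ x, (if x ∈ (Φ ω).singles then f x ω else 0) ∂(atomKernel (Φ ω)) ∂P =
        ∫⁻ φ, ∫⁻ ω, ∫⁻ x, (if x ∈ φ.singles then f x ω else 0) ∂(atomKernel φ) ∂P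
          ∂(P.map Φ) := by
    have hΦm := hΦ.measurable
    obtain ⟨𝒢, h𝒢, hind, hmeas⟩ := hf
    exact ⟨measurable_prod_of_le h𝒢 hmeas, lintegral_comp_of_indep hΦm h𝒢 hind
      (G := fun φ ω => ∫⁻ x, (if x ∈ φ.singles then f x ω else 0) ∂(atomKernel φ))
      -- Joint measurability is needed for `𝒢` itself, not only for the ambient σ-algebra, since the
      -- independence concerns `𝒢`.
      (@measurable_singles_sum Ω 𝒢 f hmeas)⟩
  simp_rw [interference₁_eq]
  refine ⟨h1.aemeasurable, h2.trans ?_⟩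
  have hmean : Measurable fun x => ∫⁻ ω, f x ω ∂P := hm.lintegral_prod_right
  rw [singlesFormula, ← lintegral_intensity, ← hΦ.lintegral_lintegral_singles hlam hmean]
  refine lintegral_congr fun φ => ?_
  -- With the configuration frozen, expectation passes through the sum over atoms and replaces `f`
  -- by its mean, to which the deterministic formula applies.
  rw [lintegral_lintegral_swap]
  · refine lintegral_congr fun x => ?_
    split_ifs <;> simp
  · exact (Measurable.ite (measurableSet_singles measurable_const measurable_snd)
      (hm.comp measurable_swap) measurable_const).aemeasurable

theorem interference₂_of_isIndepField (hΦ : IsPoissonProcess P lam Φ)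
    {g : Plane → Plane → Ω → ℝ≥0∞}
    (hg : IsIndepField P Φ fun z : Plane × Plane => g z.1 z.2) :
    AEMeasurable (fun ω => (Φ ω).interference₂ fun x y => g x y ω) P ∧
      ∫⁻ ω, (Φ ω).interference₂ (fun x y => g x y ω) ∂P = pairsFormula P lam g := by
  classical
  obtain ⟨hm, h1, h2⟩ : (Measurable fun z : (Plane × Plane) × Ω => g z.1.1 z.1.2 z.2) ∧
      (Measurable fun ω => ∫⁻ x, ∫⁻ y, (if (Φ ω).MNNR x y then g x y ω else 0)
        ∂(atomKernel (Φ ω)) ∂(atomKernel (Φ ω))) ∧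
      ∫⁻ ω, ∫⁻ x, ∫⁻ y, (if (Φ ω).MNNR x y then g x y ω else 0)
          ∂(atomKernel (Φ ω)) ∂(atomKernel (Φ ω)) ∂P =
        ∫⁻ φ, ∫⁻ ω, ∫⁻ x, ∫⁻ y, (if φ.MNNR x y then g x y ω else 0)
          ∂(atomKernel φ) ∂(atomKernel φ) ∂P ∂(P.map Φ) := by
    have hΦm := hΦ.measurable
    obtain ⟨𝒢, h𝒢, hind, hmeas⟩ := hg
    exact ⟨measurable_prod_of_le h𝒢 hmeas, lintegral_comp_of_indep hΦm h𝒢 hind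
      (G := fun φ ω => ∫⁻ x, ∫⁻ y, (if φ.MNNR x y then g x y ω else 0)
        ∂(atomKernel φ) ∂(atomKernel φ))
      (@measurable_pairs_sum Ω 𝒢 g hmeas)⟩
  simp_rw [interference₂_eq]
  refine ⟨(h1.const_mul _).aemeasurable, ?_⟩
  have hmean : Measurable (Function.uncurry fun x y => ∫⁻ ω, g x y ω ∂P) :=
    hm.lintegral_prod_right
  rw [lintegral_const_mul _ h1, h2, pairsFormula, ← lintegral_intensity]
  simp_rw [← lintegral_intensity]
  rw [← hΦ.lintegral_lintegral_MNNR hmean]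
  congr 1
  refine lintegral_congr fun φ => ?_
  have hite : Measurable fun z : (Plane × Plane) × Ω =>
      if φ.MNNR z.1.1 z.1.2 then g z.1.1 z.1.2 z.2 else 0 :=
    Measurable.ite (measurableSet_MNNR (by fun_prop) (by fun_prop) (by fun_prop)) hm
      measurable_const
  rw [lintegral_lintegral_swap]
  · refine lintegral_congr fun x => ?_
    rw [lintegral_lintegral_swap]
    · refine lintegral_congr fun y => ?_
      split_ifs <;> simp
    · exact (hite.comp (f := fun z : Ω × Plane => ((x, z.2), z.1)) (by fun_prop)).aemeasurable
  · exact (measurable_lintegral_atomKernel (measurable_const (a := φ))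
      (f := fun (z : Ω × Plane) y => if φ.MNNR z.2 y then g z.2 y z.1 else 0)
      (hite.comp (f := fun z : (Ω × Plane) × Plane => ((z.1.2, z.2), z.1.1))
        (by fun_prop))).aemeasurable

theorem atomInterference₁_of_isIndepFieldFamily (hΦ : IsPoissonProcess P lam Φ) (hlam : 0 < lam)
    {X : ℕ → Ω → Plane} (hX : IsEnumeration P Φ X) {f : Plane → Ω → ℝ≥0∞}
    {s : ℕ → Plane → Ω → ℝ≥0∞} (hs : IsIndepFieldFamily P X s)
    (hsf : ∀ n x, IdentDistrib (s n x) (f x) P P) :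
    AEMeasurable (fun ω => (Φ ω).atomInterference₁ (fun n => X n ω) fun n x => s n x ω) P ∧
      ∫⁻ ω, (Φ ω).atomInterference₁ (fun n => X n ω) (fun n x => s n x ω) ∂P =
        singlesFormula P lam f := by
  classical
  have hXm : Measurable fun ω n => X n ω := measurable_pi_lambda _ hX.measurable
  let G : ℕ → (ℕ → Plane) → Ω → ℝ≥0∞ := fun n p ω =>
    if ∀ m, ¬ SeqMNNR p n m then s n (p n) ω else 0
  obtain ⟨hm, hGi⟩ : (Measurable fun z : Plane × Ω => s 0 z.1 z.2) ∧
      ∀ n, (Measurable fun ω => G n (fun k => X k ω) ω) ∧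
        ∫⁻ ω, G n (fun k => X k ω) ω ∂P =
          ∫⁻ p, ∫⁻ ω, G n p ω ∂P ∂(P.map fun ω k => X k ω) := by
    obtain ⟨𝒢, h𝒢, hind, hmeas⟩ := hs
    exact ⟨measurable_prod_of_le h𝒢 (hmeas 0), fun n =>
      lintegral_comp_of_indep hXm h𝒢 hind (@measurable_seqSingles_term Ω 𝒢 (s n) (hmeas n) n)⟩
  -- No joint measurability of `f` is assumed; its mean inherits measurability from that of `s 0`,
  -- which has the same law at each position.
  have hmean : Measurable fun x => ∫⁻ ω, f x ω ∂P := by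
    simp_rw [← fun x => (hsf 0 x).lintegral_eq]
    exact hm.lintegral_prod_right
  have hae : (fun ω => (Φ ω).atomInterference₁ (fun n => X n ω) fun n x => s n x ω) =ᵐ[P]
      fun ω => ∑' n, G n (fun k => X k ω) ω := hX.enum.mono fun ω hω => by
    refine tsum_congr fun n => ?_
    simp only [G, ← mem_singles_iff_seqMNNR hω.2]
  have hsum : Measurable fun ω => ∑' n, G n (fun k => X k ω) ω :=
    Measurable.tsum fun n => (hGi n).1
  refine ⟨⟨_, hsum, hae⟩, ?_⟩
  have hH : ∀ n, Measurable fun p : ℕ → Plane =>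
      if ∀ m, ¬ SeqMNNR p n m then ∫⁻ ω, f (p n) ω ∂P else 0 := fun n =>
    Measurable.ite (measurableSet_forall_not_seqMNNR n) (hmean.comp (measurable_pi_apply n))
      measurable_const
  rw [lintegral_congr_ae hae, lintegral_tsum fun n => (hGi n).1.aemeasurable, singlesFormula,
    ← lintegral_intensity, ← hΦ.lintegral_lintegral_singles hlam hmean,
    lintegral_map (f := fun φ : Config =>
        ∫⁻ x, (if x ∈ φ.singles then ∫⁻ ω, f x ω ∂P else 0) ∂(atomKernel φ))
      -- A one-point sample space specialises the joint statement to a deterministic field.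
      ((measurable_singles_sum (Ω' := Unit) (f := fun x _ => ∫⁻ ω, f x ω ∂P)
        (hmean.comp measurable_fst)).comp (measurable_id.prodMk (measurable_const (a := ()))))
      hΦ.measurable]
  -- With the sequence frozen, the `n`-th term involves `s n` only at the fixed position `p n`, so
  -- its mean depends only on that one-point law.
  have hstep : ∀ n, ∫⁻ ω, G n (fun k => X k ω) ω ∂P =
      ∫⁻ ω, (if ∀ m, ¬ SeqMNNR (fun k => X k ω) n m then ∫⁻ ω', f (X n ω) ω' ∂P else 0) ∂P :=
      fun n => by
    rw [(hGi n).2, ← lintegral_map (hH n) hXm]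
    refine lintegral_congr fun p => ?_
    simp only [G]
    split_ifs
    · exact (hsf n (p n)).lintegral_eq
    · exact lintegral_zero
  have hHX : ∀ n, Measurable fun ω =>
      if ∀ m, ¬ SeqMNNR (fun k => X k ω) n m then ∫⁻ ω', f (X n ω) ω' ∂P else 0 :=
    fun n => (hH n).comp hXm
  rw [tsum_congr hstep, ← lintegral_tsum fun n => (hHX n).aemeasurable]
  refine lintegral_congr_ae (hX.enum.mono fun ω hω => ?_)
  dsimp only
  rw [lintegral_atomKernel_of_range hω.1 hω.2]
  refine tsum_congr fun n => ?_
  simp only [← mem_singles_iff_seqMNNR hω.2]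

theorem atomInterference₂_of_isIndepFieldFamily (hΦ : IsPoissonProcess P lam Φ)
    {X : ℕ → Ω → Plane} (hX : IsEnumeration P Φ X) {g : Plane → Plane → Ω → ℝ≥0∞}
    {t : ℕ → ℕ → Plane → Plane → Ω → ℝ≥0∞}
    (ht : IsIndepFieldFamily P X
      fun (i : ℕ × ℕ) (z : Plane × Plane) => t i.1 i.2 z.1 z.2)
    (htg : ∀ n m, n ≠ m → ∀ x y, IdentDistrib (t n m x y) (g x y) P P) :
    AEMeasurable
        (fun ω => (Φ ω).atomInterference₂ (fun n => X n ω) fun n m x y => t n m x y ω) P ∧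
      ∫⁻ ω, (Φ ω).atomInterference₂ (fun n => X n ω) (fun n m x y => t n m x y ω) ∂P =
        pairsFormula P lam g := by
  classical
  have hXm : Measurable fun ω n => X n ω := measurable_pi_lambda _ hX.measurable
  let G : ℕ → ℕ → (ℕ → Plane) → Ω → ℝ≥0∞ := fun n m p ω =>
    if SeqMNNR p n m then t n m (p n) (p m) ω else 0
  obtain ⟨hm, hGi⟩ : (Measurable fun z : (Plane × Plane) × Ω => t 0 1 z.1.1 z.1.2 z.2) ∧
      ∀ n m, (Measurable fun ω => G n m (fun k => X k ω) ω) ∧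
        ∫⁻ ω, G n m (fun k => X k ω) ω ∂P =
          ∫⁻ p, ∫⁻ ω, G n m p ω ∂P ∂(P.map fun ω k => X k ω) := by
    obtain ⟨𝒢, h𝒢, hind, hmeas⟩ := ht
    exact ⟨measurable_prod_of_le h𝒢 (hmeas (0, 1)), fun n m =>
      lintegral_comp_of_indep hXm h𝒢 hind
        (@measurable_seqPairs_term Ω 𝒢 (t n m) (hmeas (n, m)) n m)⟩
  have hmean : Measurable (Function.uncurry fun x y => ∫⁻ ω, g x y ω ∂P) := by
    -- The pair of indices `0`, `1` is an arbitrary off-diagonal choice: the laws are prescribed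
    -- only for `n ≠ m`.
    simp_rw [← fun x y => (htg 0 1 zero_ne_one x y).lintegral_eq]
    exact hm.lintegral_prod_right
  have hae : (fun ω => (Φ ω).atomInterference₂ (fun n => X n ω) fun n m x y => t n m x y ω) =ᵐ[P]
      fun ω => 2⁻¹ * ∑' n, ∑' m, G n m (fun k => X k ω) ω := hX.enum.mono fun ω hω => by
    dsimp only [atomInterference₂]
    congr 1
    refine tsum_congr fun n => tsum_congr fun m => ?_
    simp only [G, ← MNNR_iff_seqMNNR hω.2]
    refine if_congr (and_iff_right_of_imp fun h hnm => h.1.2.2.1 ?_) rfl rfl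
    rw [hnm]
  have hinner : ∀ n, Measurable fun ω => ∑' m, G n m (fun k => X k ω) ω := fun n =>
    Measurable.tsum fun m => (hGi n m).1
  have hsum : Measurable fun ω => ∑' n, ∑' m, G n m (fun k => X k ω) ω :=
    Measurable.tsum hinner
  refine ⟨⟨_, hsum.const_mul _, hae⟩, ?_⟩
  have hH : ∀ n m, Measurable fun p : ℕ → Plane =>
      if SeqMNNR p n m then ∫⁻ ω, g (p n) (p m) ω ∂P else 0 := fun n m =>
    Measurable.ite (measurableSet_seqMNNR n m)
      (hmean.comp (f := fun p : ℕ → Plane => (p n, p m)) (by fun_prop)) measurable_const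
  rw [lintegral_congr_ae hae, lintegral_const_mul _ hsum,
    lintegral_tsum fun n => (hinner n).aemeasurable, pairsFormula, ← lintegral_intensity]
  simp_rw [← lintegral_intensity]
  rw [← hΦ.lintegral_lintegral_MNNR hmean,
    lintegral_map (f := fun φ : Config => ∫⁻ x, ∫⁻ y,
        (if φ.MNNR x y then ∫⁻ ω, g x y ω ∂P else 0) ∂(atomKernel φ) ∂(atomKernel φ))
      ((measurable_pairs_sum (Ω' := Unit) (g := fun x y _ => ∫⁻ ω, g x y ω ∂P)
        (hmean.comp measurable_fst)).comp (measurable_id.prodMk (measurable_const (a := ()))))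
      hΦ.measurable]
  have hstep : ∀ n m, ∫⁻ ω, G n m (fun k => X k ω) ω ∂P =
      ∫⁻ ω, (if SeqMNNR (fun k => X k ω) n m then ∫⁻ ω', g (X n ω) (X m ω) ω' ∂P else 0) ∂P :=
      fun n m => by
    rw [(hGi n m).2, ← lintegral_map (hH n m) hXm]
    refine lintegral_congr fun p => ?_
    simp only [G]
    split_ifs with h
    -- Neighbours occupy distinct positions, so `n = m` cannot occur and the missing diagonal laws
    -- are never needed.
    · exact (htg n m (fun hnm => h.1.1 (by rw [hnm])) (p n) (p m)).lintegral_eq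
    · exact lintegral_zero
  have hHX : ∀ n m, Measurable fun ω =>
      if SeqMNNR (fun k => X k ω) n m then ∫⁻ ω', g (X n ω) (X m ω) ω' ∂P else 0 :=
    fun n m => (hH n m).comp hXm
  have hstep' : ∀ n, ∫⁻ ω, ∑' m, G n m (fun k => X k ω) ω ∂P =
      ∫⁻ ω, ∑' m, (if SeqMNNR (fun k => X k ω) n m then ∫⁻ ω', g (X n ω) (X m ω) ω' ∂P else 0)
        ∂P := fun n => by
    rw [lintegral_tsum fun m => (hGi n m).1.aemeasurable, tsum_congr (hstep n),
      lintegral_tsum fun m => (hHX n m).aemeasurable]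
  rw [tsum_congr hstep']
  rw [← lintegral_tsum fun n => (Measurable.tsum fun m => hHX n m).aemeasurable]
  congr 1
  refine lintegral_congr_ae (hX.enum.mono fun ω hω => ?_)
  dsimp only
  rw [lintegral_atomKernel_of_range hω.1 hω.2]
  refine tsum_congr fun n => ?_
  rw [lintegral_atomKernel_of_range hω.1 hω.2]
  refine tsum_congr fun m => ?_
  simp only [← MNNR_iff_seqMNNR hω.2]

end IsPoissonProcess

end MutualNN

theorem theorem4 {Ω : Type*} [MeasurableSpace Ω] (P : Measure Ω) [IsProbabilityMeasure P]
    (lam : ℝ≥0) (hlam : 0 < lam) (Φ : Ω → MutualNN.Config)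
    (hΦ : MutualNN.IsPoissonProcess P lam Φ) :
    -- random fields `f`, `g` independent of `Φ`
    (∀ f : MutualNN.Plane → Ω → ℝ≥0∞, MutualNN.IsIndepField P Φ f →
      AEMeasurable (fun ω => (Φ ω).interference₁ (fun x => f x ω)) P ∧
      ∫⁻ ω, (Φ ω).interference₁ (fun x => f x ω) ∂P = MutualNN.singlesFormula P lam f) ∧
    (∀ g : MutualNN.Plane → MutualNN.Plane → Ω → ℝ≥0∞,
      MutualNN.IsIndepField P Φ (fun z : MutualNN.Plane × MutualNN.Plane => g z.1 z.2) →
      AEMeasurable (fun ω => (Φ ω).interference₂ (fun x y => g x y ω)) P ∧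
      ∫⁻ ω, (Φ ω).interference₂ (fun x y => g x y ω) ∂P = MutualNN.pairsFormula P lam g) ∧
    -- the atoms (pairs) use their own copies of the signals, e.g. i.i.d. fading variables
    (∀ X : ℕ → Ω → MutualNN.Plane, MutualNN.IsEnumeration P Φ X →
      (∀ (f : MutualNN.Plane → Ω → ℝ≥0∞) (s : ℕ → MutualNN.Plane → Ω → ℝ≥0∞),
        MutualNN.IsIndepFieldFamily P X s →
        (∀ n x, IdentDistrib (s n x) (f x) P P) →
        AEMeasurable (fun ω => (Φ ω).atomInterference₁ (fun n => X n ω) (fun n x => s n x ω)) P ∧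
        ∫⁻ ω, (Φ ω).atomInterference₁ (fun n => X n ω) (fun n x => s n x ω) ∂P =
          MutualNN.singlesFormula P lam f) ∧
      (∀ (g : MutualNN.Plane → MutualNN.Plane → Ω → ℝ≥0∞)
        (t : ℕ → ℕ → MutualNN.Plane → MutualNN.Plane → Ω → ℝ≥0∞),
        MutualNN.IsIndepFieldFamily P X
          (fun (i : ℕ × ℕ) (z : MutualNN.Plane × MutualNN.Plane) => t i.1 i.2 z.1 z.2) →
        (∀ n m, n ≠ m → ∀ x y, IdentDistrib (t n m x y) (g x y) P P) →
        AEMeasurable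
          (fun ω => (Φ ω).atomInterference₂ (fun n => X n ω) (fun n m x y => t n m x y ω)) P ∧
        ∫⁻ ω, (Φ ω).atomInterference₂ (fun n => X n ω) (fun n m x y => t n m x y ω) ∂P =
          MutualNN.pairsFormula P lam g)) := by
  refine ⟨fun f hf => hΦ.interference₁_of_isIndepField hlam hf,
    fun g hg => hΦ.interference₂_of_isIndepField hg, fun X hX => ⟨fun f s hs hsf => ?_,
      fun g t ht htg => ?_⟩⟩
  · exact hΦ.atomInterference₁_of_isIndepFieldFamily hlam hX hs hsf
  · exact hΦ.atomInterference₂_of_isIndepFieldFamily hX ht htg
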